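/- Let $U\subset\mathbb R^n$ be open, with coordinates $R=(R^1,\dots,R^n)$; all functions below are smooth on $U$. Let $ds^2=\sum_i g_{ii}(R)(dR^i)^2$, $g_{ii}\ne 0$ (of any signature), be a flat diagonal metric, $\nabla$ its Levi-Civita connection, and let $$R^i_{t^\beta}=v^i_\beta(R)\,R^i_{t^1},\qquad i=1,\dots,n,\quad \beta=1,\dots,N,\qquad t^1=x,\quad v^i_1\equiv 1,$$ be (commuting) diagonal flows which are Hamiltonian with respect to this metric: there are densities $h_\beta$ with $\nabla^i\nabla_j h_\beta=v^i_\beta\delta^i_j$. Let $a^\gamma_1$ $(\gamma=1,\dots,N)$ be conserved densities of these flows with fluxes $a^\gamma_\beta$, i.e. $\partial_i a^\gamma_\beta=v^i_\beta\,\partial_i a^\gamma_1$ (no sum over $i$), let the matrix $(a^\gamma_\beta)$ be invertible with inverse $(A^\beta_\gamma)$, and consider the generalized reciprocal transformation $d\tilde t^\gamma=a^\gamma_\beta\,dt^\beta$ (summation over repeated Greek indices), $\tilde x=\tilde t^1$. Assume $A^\nu_1v^i_\nu\neq0$ for all $i$. Assume also that the Hamiltonian flows generated by the densities $a^\gamma_1$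 are diagonal, i.e. $\nabla^i\nabla_ja_1^\gamma=0$ for $i\ne j$ (this is automatic, and need only be required at points where $v^i_\beta=v^j_\beta$ for all $\beta$); put $w^i_\gamma=\nabla^i\nabla_i a^\gamma_1$ (no sum over $i$). Let $c^\gamma_\beta$ be fluxes of $a^\gamma_1$ along the flows $R^i_{\tau^\beta}=w^i_\beta R^i_x$, i.e. $\partial_i c^\gamma_\beta=w^i_\beta\,\partial_i a^\gamma_1$, normalized by $$c^\beta_\gamma+c^\gamma_\beta=\sum_k g^{kk}\,\partial_k a^\beta_1\,\partial_k a^\gamma_1 .$$ Set $$\tilde g_{ii}=g_{ii}\,(A^\nu_1v^i_\nu)^2,\qquad \tilde v^i_\beta=\frac{A^\gamma_\beta v^i_\gamma}{A^\nu_1v^i_\nu},\qquad \tilde w^i_\gamma=\frac{w^i_\gamma-c^\beta_\gamma A^\varepsilon_\beta v^i_\varepsilon}{A^\nu_1v^i_\nu}.$$ Then the curvature tensor of the metric $d\tilde s^2=\sum_i\tilde g_{ii}(dR^i)^2$ is given by $$\tilde R^{ij}_{ij}=\sum_{\beta=1}^N\left(\tilde v^i_\beta\tilde w^j_\beta+\tilde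 v^j_\beta\tilde w^i_\beta\right)\quad(i\ne j,\ \text{no sum over } i,j),$$ and all its components $\tilde R^{ij}_{kl}$ with $\{k,l\}\neq\{i,j\}$ vanish; equivalently $\tilde R^{ij}_{kl}=\sum_{\beta}(\tilde v^i_\beta\tilde w^j_\beta+\tilde v^j_\beta\tilde w^i_\beta)(\delta^i_k\delta^j_l-\delta^i_l\delta^j_k)$ for all $i,j,k,l$ (no sum over Latin indices; the sign convention is the one in which a metric of constant curvature $c$ has $R^{ij}_{kl}=c(\delta^i_k\delta^j_l-\delta^i_l\delta^j_k)$). Moreover, with $\tilde\Gamma$ the Christoffel symbols of $d\tilde s^2$, the nonlocal operator with $2N$ tails $$\tilde J^{ij}=\tilde g^{ii}\delta^{ij}\frac{d}{d\tilde x}-\tilde g^{ii}\sum_k\tilde\Gamma^j_{ik}R^k_{\tilde x}+\sum_{\beta=1}^N\tilde v^i_\beta R^i_{\tilde x}\Big(\frac{d}{d\tilde x}\Big)^{-1}\tilde w^j_\beta R^j_{\tilde x}+\sum_{\beta=1}^N\tilde w^i_\beta R^i_{\tilde x}\Big(\frac{d}{d\tilde x}\Big)^{-1}\tilde v^j_\beta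 R^j_{\tilde x}$$ is Hamiltonian: with the skew-symmetric $\left(\frac{d}{dx}\right)^{-1}f(x)=\frac12\left(\int_{-\infty}^xf-\int_x^\infty f\right)$, the bracket $\{R^i(x),R^j(y)\}=\tilde J^{ij}\delta(x-y)$, tested against smooth compactly supported covector fields, is skew-symmetric and satisfies the Jacobi identity at every smooth field $R:\mathbb R\to U$. -/

import Mathlib

open scoped ContDiff

noncomputable section

namespace RecipTransf

/-- Partial derivative `∂_i f` at the point `R`. -/
def pd {n : ℕ} (i : Fin n) (f : (Fin n → ℝ) → ℝ) (R : Fin n → ℝ) : ℝ :=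
  fderiv ℝ f R (Pi.single i 1)

/-- Christoffel symbol `Γ^k_{ij}` of the Levi-Civita connection of the (pseudo-Riemannian) metric
with covariant components `G`. -/
def christoffel {n : ℕ} (G : (Fin n → ℝ) → Matrix (Fin n) (Fin n) ℝ) (k i j : Fin n)
    (R : Fin n → ℝ) : ℝ :=
  (1 / 2 : ℝ) * ∑ l, (G R)⁻¹ k l *
    (pd i (fun S => G S l j) R + pd j (fun S => G S l i) R - pd l (fun S => G S i j) R)

/-- Riemann tensor `R^i_{jkl} = ∂_k Γ^i_{lj} - ∂_l Γ^i_{kj} + Γ^i_{km} Γ^m_{lj} - Γ^i_{lm} Γ^m_{kj}`. -/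
def riemann {n : ℕ} (G : (Fin n → ℝ) → Matrix (Fin n) (Fin n) ℝ) (i j k l : Fin n)
    (R : Fin n → ℝ) : ℝ :=
  pd k (christoffel G i l j) R - pd l (christoffel G i k j) R
    + ∑ m, (christoffel G i k m R * christoffel G m l j R
      - christoffel G i l m R * christoffel G m k j R)

/-- Curvature tensor `R^{ij}_{kl} = g^{js} R^i_{skl}`.  The sign is such that a metric of constant
curvature `c` has `R^{ij}_{kl} = c (δ^i_k δ^j_l - δ^i_l δ^j_k)`. -/
def curvature {n : ℕ} (G : (Fin n → ℝ) → Matrix (Fin n) (Fin n) ℝ) (i j k l : Fin n)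
    (R : Fin n → ℝ) : ℝ :=
  ∑ s, (G R)⁻¹ j s * riemann G i s k l R

/-- `∇^i ∇_j h = g^{is} (∂_s ∂_j h - Γ^k_{sj} ∂_k h)`. -/
def mixedHess {n : ℕ} (G : (Fin n → ℝ) → Matrix (Fin n) (Fin n) ℝ)
    (h : (Fin n → ℝ) → ℝ) (i j : Fin n) (R : Fin n → ℝ) : ℝ :=
  ∑ s, (G R)⁻¹ i s * (pd s (pd j h) R - ∑ k, christoffel G k s j R * pd k h R)

/-- The diagonal metric `∑ g_i (dR^i)²`. -/
def diagMetric {n : ℕ} (g : Fin n → (Fin n → ℝ) → ℝ) (R : Fin n → ℝ) :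
    Matrix (Fin n) (Fin n) ℝ :=
  Matrix.diagonal fun i => g i R

/-- The inverse matrix: `invMat a ν γ = A^ν_γ`, where `a γ β = a^γ_β`. -/
def invMat {n N : ℕ} (a : Fin N → Fin N → (Fin n → ℝ) → ℝ) (ν γ : Fin N)
    (R : Fin n → ℝ) : ℝ :=
  (Matrix.of fun γ' β => a γ' β R)⁻¹ ν γ

/-- `A^γ_β v^i_γ` (sum over `γ`). -/
def speedSum {n N : ℕ} (a : Fin N → Fin N → (Fin n → ℝ) → ℝ)
    (v : Fin N → Fin n → (Fin n → ℝ) → ℝ) (β : Fin N) (i : Fin n) (R : Fin n → ℝ) : ℝ :=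
  ∑ γ, invMat a γ β R * v γ i R

/-- Transformed metric `g̃_ii = g_ii (A^ν_1 v^i_ν)²`; the index `0` of `Fin N` is the index of
`t^1 = x`. -/
def newMetric {n N : ℕ} [NeZero N] (g : Fin n → (Fin n → ℝ) → ℝ)
    (a : Fin N → Fin N → (Fin n → ℝ) → ℝ) (v : Fin N → Fin n → (Fin n → ℝ) → ℝ)
    (i : Fin n) (R : Fin n → ℝ) : ℝ :=
  g i R * speedSum a v 0 i R ^ 2

/-- Transformed speeds `ṽ^i_β = A^γ_β v^i_γ / A^ν_1 v^i_ν`. -/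
def newSpeed {n N : ℕ} [NeZero N] (a : Fin N → Fin N → (Fin n → ℝ) → ℝ)
    (v : Fin N → Fin n → (Fin n → ℝ) → ℝ) (β : Fin N) (i : Fin n) (R : Fin n → ℝ) : ℝ :=
  speedSum a v β i R / speedSum a v 0 i R

/-- Speeds `w^i_γ = ∇^i ∇_i a^γ_1` of the flows generated by the densities `a^γ_1`. -/
def extraSpeed {n N : ℕ} [NeZero N] (g : Fin n → (Fin n → ℝ) → ℝ)
    (a : Fin N → Fin N → (Fin n → ℝ) → ℝ) (γ : Fin N) (i : Fin n) (R : Fin n → ℝ) : ℝ :=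
  mixedHess (diagMetric g) (a γ 0) i i R

/-- Transformed speeds `w̃^i_γ = (w^i_γ - c^β_γ A^ε_β v^i_ε) / A^ν_1 v^i_ν`, where
`c β γ = c^β_γ`. -/
def newExtraSpeed {n N : ℕ} [NeZero N] (g : Fin n → (Fin n → ℝ) → ℝ)
    (a c : Fin N → Fin N → (Fin n → ℝ) → ℝ) (v : Fin N → Fin n → (Fin n → ℝ) → ℝ)
    (γ : Fin N) (i : Fin n) (R : Fin n → ℝ) : ℝ :=
  (extraSpeed g a γ i R - ∑ β, c β γ R * speedSum a v β i R) / speedSum a v 0 i R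

/-- The skew-symmetric antiderivative
`((d/dx)⁻¹ f)(x) = ½ (∫_{-∞}^x f - ∫_x^∞ f)`. -/
def invD (f : ℝ → ℝ) (x : ℝ) : ℝ :=
  (1 / 2 : ℝ) * ((∫ y in Set.Iic x, f y) - ∫ y in Set.Ioi x, f y)

/-- The operator
`J^{ij} = g^{ij} d/dx - g^{is} Γ^j_{sk} R^k_x + ∑_β p^i_β R^i_x (d/dx)⁻¹ q^j_β R^j_x
  + ∑_β q^i_β R^i_x (d/dx)⁻¹ p^j_β R^j_x`
at the field `R = R(x)`, applied to the covector field `ψ = ψ(x)`: the value is `(J ψ)^i (x)`. -/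
def nonlocalOp {n N : ℕ} (G : (Fin n → ℝ) → Matrix (Fin n) (Fin n) ℝ)
    (p q : Fin N → Fin n → (Fin n → ℝ) → ℝ)
    (R ψ : ℝ → Fin n → ℝ) (x : ℝ) (i : Fin n) : ℝ :=
  (∑ j, (G (R x))⁻¹ i j * deriv (fun y => ψ y j) x)
    - (∑ j, ∑ s, ∑ k, (G (R x))⁻¹ i s * christoffel G j s k (R x)
        * deriv (fun y => R y k) x * ψ x j)
    + (∑ β, p β i (R x) * deriv (fun y => R y i) x
        * invD (fun y => ∑ j, q β j (R y) * deriv (fun z => R z j) y * ψ y j) x)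
    + ∑ β, q β i (R x) * deriv (fun y => R y i) x
        * invD (fun y => ∑ j, p β j (R y) * deriv (fun z => R z j) y * ψ y j) x

/-- The Poisson bracket `{F_ξ, F_η} = ∫ ξ_i J^{ij} η_j dx`, at the field `R`, of the linear
functionals `F_ξ[R] = ∫ ξ_i R^i dx` and `F_η[R] = ∫ η_i R^i dx`; it is the distribution
`{R^i(x), R^j(y)} = J^{ij} δ(x - y)` paired with `ξ_i(x) η_j(y)`. -/
def bracket {n : ℕ} (J : (ℝ → Fin n → ℝ) → (ℝ → Fin n → ℝ) → ℝ → Fin n → ℝ)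
    (ξ η : ℝ → Fin n → ℝ) (R : ℝ → Fin n → ℝ) : ℝ :=
  ∫ x, ∑ i, ξ x i * J R η x i

/-- The derivative of `{F_ξ, F_η}` at `R` along the Hamiltonian vector field `J ζ` of `F_ζ`, that
is, the double bracket `{{F_ξ, F_η}, F_ζ}`. -/
def doubleBracket {n : ℕ} (J : (ℝ → Fin n → ℝ) → (ℝ → Fin n → ℝ) → ℝ → Fin n → ℝ)
    (ξ η ζ : ℝ → Fin n → ℝ) (R : ℝ → Fin n → ℝ) : ℝ :=
  deriv (fun ε : ℝ => bracket J ξ η (fun x => R x + ε • J R ζ x)) 0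

/-- Test covector fields: smooth with compact support. -/
def IsTest {n : ℕ} (ξ : ℝ → Fin n → ℝ) : Prop :=
  ContDiff ℝ ∞ ξ ∧ HasCompactSupport ξ

/-- `J` is a Hamiltonian operator on fields with values in `U`: the bracket is well defined,
skew-symmetric, differentiable along Hamiltonian vector fields, and satisfies the Jacobi
identity, at every smooth field `R : ℝ → U`. -/
structure IsHamiltonian {n : ℕ} (U : Set (Fin n → ℝ))
    (J : (ℝ → Fin n → ℝ) → (ℝ → Fin n → ℝ) → ℝ → Fin n → ℝ) : Prop where
  integrable : ∀ R : ℝ → Fin n → ℝ, ContDiff ℝ ∞ R → (∀ x, R x ∈ U) →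
    ∀ ξ η, IsTest ξ → IsTest η →
      MeasureTheory.Integrable (fun x => ∑ i, ξ x i * J R η x i)
  skew : ∀ R : ℝ → Fin n → ℝ, ContDiff ℝ ∞ R → (∀ x, R x ∈ U) →
    ∀ ξ η, IsTest ξ → IsTest η → bracket J ξ η R = - bracket J η ξ R
  differentiable : ∀ R : ℝ → Fin n → ℝ, ContDiff ℝ ∞ R → (∀ x, R x ∈ U) →
    ∀ ξ η ζ, IsTest ξ → IsTest η → IsTest ζ →
      DifferentiableAt ℝ (fun ε : ℝ => bracket J ξ η (fun x => R x + ε • J R ζ x)) 0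
  jacobi : ∀ R : ℝ → Fin n → ℝ, ContDiff ℝ ∞ R → (∀ x, R x ∈ U) →
    ∀ ξ η ζ, IsTest ξ → IsTest η → IsTest ζ →
      doubleBracket J ξ η ζ R + doubleBracket J η ζ ξ R + doubleBracket J ζ ξ η R = 0

end RecipTransf

end

/-! Curvature. Put `s^i_β = A^γ_β v^i_γ` and `u_ij = ∑_ε s^i_ε ∂_j a^ε_1`, and write `Γ_ij` for `∂_j
ln √|g_ii|`. Flatness gives the Codazzi equations `∂_j w^i = Γ_ij (w^j - w^i)` for the speeds of
every diagonal flow generated by a density (`codazzi_of_mixedHess`). With the conservation laws they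
show that, for each β, the `s^i_β` solve one linear system `∂_j y^i = (Γ_ij - u_ij) y^j - Γ_ij y^i`,
`i ≠ j`, whose coefficients do not depend on β (`pd_speedSum`). The numerators of the `w̃^i_γ` solve
the same system (`pd_shiftedExtraSpeed`). The quotient of any solution by `s^i_1` then satisfies the
Codazzi equations of `g̃_ii = g_ii (s^i_1)²` (`codazzi_div`).

In the frame `∂_i / s^i_1`, whose Gram matrix is the old metric, the Levi-Civita connection of `g̃`
becomes the flat one plus a term linear in `u` and skew with respect to `g` (`christoffel_mul_sq`).
Its curvature, computed from the equations for the derivatives of `u`, is governed by `∑_ε (s^k_ε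
w^l_ε + s^l_ε w^k_ε)` minus the inner product of the covectors `u_k` and `u_l`
(`curvature_dressedConn`). The normalization of the `c^γ_β` turns this inner product into exactly
the shifts by which the numerators of the `w̃` differ from the `w`, which gives the stated formula
(`curvature_newMetric`).

Hamiltonian property. The Jacobi identity is proved for any operator `q^i D + ∑_α W_α R_x (d/dx)⁻¹
W_{σα} R_x` with a torsion-free metric connection, diagonal affinors, an involution `σ`, and the
Gauss and Codazzi equations (`HydroStructure`). Test covectors are varied covariantly along `V =
Jζ`: `δξ_i = -Γ^j_{ki} V^k ξ_j`. The commutator of this variation with `D` is the curvature. By the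
Gauss equation it cancels the local terms that the nonlocal part leaves after integration by parts;
the Codazzi equations make that integration by parts covariant. What remains of a double bracket
(`doubleBracket_eq`) is `δξ·Jη - δη·Jξ` plus `Jζ·(Dη tail ξ - Dξ tail η)`. In the cyclic sum the
first kind cancels because the connection is torsion-free. The second kind adds up, for each
component, to a determinant with rows `J`, `D` and `tail`, and `J` is a combination of the other two
rows. -/

noncomputable section
namespace RecipTransf

/-! ### Calculus of partial derivatives on an open set. -/

section PartialDerivatives

variable {n : ℕ} {U : Set (Fin n → ℝ)} {f f' : (Fin n → ℝ) → ℝ} {R : Fin n → ℝ}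

theorem contDiffAt_of_mem (hU : IsOpen U) (hf : ContDiffOn ℝ ∞ f U) (hR : R ∈ U) :
    ContDiffAt ℝ ∞ f R := hf.contDiffAt (hU.mem_nhds hR)

theorem differentiableAt_of_mem (hU : IsOpen U) (hf : ContDiffOn ℝ ∞ f U) (hR : R ∈ U) :
    DifferentiableAt ℝ f R := (contDiffAt_of_mem hU hf hR).differentiableAt (by simp)

theorem contDiffOn_pd (hU : IsOpen U) (hf : ContDiffOn ℝ ∞ f U) (i : Fin n) :
    ContDiffOn ℝ ∞ (pd i f) U :=
  (hf.fderiv_of_isOpen hU (by simp)).clm_apply contDiffOn_const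

theorem pd_congr (hU : IsOpen U) (h : ∀ S ∈ U, f S = f' S) (hR : R ∈ U) (i : Fin n) :
    pd i f R = pd i f' R := by
  unfold pd
  rw [Filter.EventuallyEq.fderiv_eq]
  filter_upwards [hU.mem_nhds hR] with S hS using h S hS

theorem pd_comm (hU : IsOpen U) (hf : ContDiffOn ℝ ∞ f U) (hR : R ∈ U) (i j : Fin n) :
    pd i (pd j f) R = pd j (pd i f) R := by
  have hd : DifferentiableAt ℝ (fderiv ℝ f) R :=
    ((hf.fderiv_of_isOpen hU (m := ∞) (by simp)).contDiffAt (hU.mem_nhds hR)).differentiableAt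
      (by simp)
  have key : ∀ i j : Fin n, pd i (pd j f) R
      = fderiv ℝ (fderiv ℝ f) R (Pi.single i 1) (Pi.single j 1) := by
    intro i j
    unfold pd
    rw [fderiv_clm_apply hd (differentiableAt_const _)]
    simp
  rw [key, key]
  exact ((contDiffAt_of_mem hU hf hR).isSymmSndFDerivAt
    (by simpa using WithTop.coe_le_coe.2 (le_top : (2 : ℕ∞) ≤ ⊤))).eq _ _

theorem fderiv_eq_sum_pd (f : (Fin n → ℝ) → ℝ) (R w : Fin n → ℝ) :
    fderiv ℝ f R w = ∑ k, pd k f R * w k := by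
  conv_lhs => rw [pi_eq_sum_univ' w]
  simp [pd, map_sum, mul_comm]

@[simp] theorem pd_const (c : ℝ) (i : Fin n) : pd i (fun _ => c) R = 0 := by
  simp [pd]

theorem pd_add (hf : DifferentiableAt ℝ f R) (hf' : DifferentiableAt ℝ f' R) (i : Fin n) :
    pd i (fun S => f S + f' S) R = pd i f R + pd i f' R := by
  simp [pd, fderiv_fun_add hf hf']

theorem pd_sub (hf : DifferentiableAt ℝ f R) (hf' : DifferentiableAt ℝ f' R) (i : Fin n) :
    pd i (fun S => f S - f' S) R = pd i f R - pd i f' R := by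
  simp [pd, fderiv_fun_sub hf hf']

theorem pd_mul (hf : DifferentiableAt ℝ f R) (hf' : DifferentiableAt ℝ f' R) (i : Fin n) :
    pd i (fun S => f S * f' S) R = pd i f R * f' R + f R * pd i f' R := by
  simp [pd, fderiv_fun_mul hf hf']
  ring

theorem pd_inv (hf : DifferentiableAt ℝ f R) (h0 : f R ≠ 0) (i : Fin n) :
    pd i (fun S => (f S)⁻¹) R = - pd i f R / f R ^ 2 := by
  unfold pd
  have := ((hasDerivAt_inv h0).comp_hasFDerivAt R hf.hasFDerivAt).fderiv
  rw [show (fun S => (f S)⁻¹) = (fun y => y⁻¹) ∘ f from rfl, this]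
  simp [div_eq_inv_mul]

theorem pd_div (hf : DifferentiableAt ℝ f R) (hf' : DifferentiableAt ℝ f' R) (h0 : f' R ≠ 0)
    (i : Fin n) :
    pd i (fun S => f S / f' S) R = (pd i f R * f' R - f R * pd i f' R) / f' R ^ 2 := by
  simp only [div_eq_mul_inv]
  rw [pd_mul hf (f' := fun S => (f' S)⁻¹) (hf'.inv h0), pd_inv hf' h0]
  field_simp
  ring

theorem pd_sum {ι : Type*} (s : Finset ι) {F : ι → (Fin n → ℝ) → ℝ}
    (hF : ∀ a ∈ s, DifferentiableAt ℝ (F a) R) (i : Fin n) :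
    pd i (fun S => ∑ a ∈ s, F a S) R = ∑ a ∈ s, pd i (F a) R := by
  simp [pd, fderiv_fun_sum hF]

end PartialDerivatives

/-! ### Diagonal metrics, Hessians and Codazzi equations. -/

section DiagonalMetric

variable {n : ℕ} {U : Set (Fin n → ℝ)} {g : Fin n → (Fin n → ℝ) → ℝ} {R : Fin n → ℝ}

/-- `∂_j ln √|g_i|`. -/
def logDeriv {n : ℕ} (g : Fin n → (Fin n → ℝ) → ℝ) (i j : Fin n) (R : Fin n → ℝ) : ℝ :=
  pd j (g i) R / (2 * g i R)

theorem pd_metric (h0 : ∀ i, g i R ≠ 0) (i j : Fin n) :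
    pd j (g i) R = 2 * g i R * logDeriv g i j R := by
  unfold logDeriv; field_simp [h0 i]

theorem inv_diagMetric_of_ne {i j : Fin n} (hij : i ≠ j) : (diagMetric g R)⁻¹ i j = 0 := by
  rw [diagMetric, Matrix.inv_diagonal, Matrix.diagonal_apply_ne _ hij]

theorem inv_diagMetric (h0 : ∀ i, g i R ≠ 0) (i j : Fin n) :
    (diagMetric g R)⁻¹ i j = if i = j then (g i R)⁻¹ else 0 := by
  have : (diagMetric g R)⁻¹ = Matrix.diagonal fun i => (g i R)⁻¹ := by
    apply Matrix.inv_eq_right_inv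
    rw [diagMetric, Matrix.diagonal_mul_diagonal]
    simp [h0]
  rw [this, Matrix.diagonal_apply]

theorem pd_diagMetric (i j k : Fin n) :
    pd k (fun S => diagMetric g S i j) R = if i = j then pd k (g i) R else 0 := by
  by_cases h : i = j
  · subst h; simp [diagMetric]
  · simp [diagMetric, h]

theorem christoffel_diag (h0 : ∀ i, g i R ≠ 0) (k i j : Fin n) :
    christoffel (diagMetric g) k i j R
      = (if k = j then logDeriv g k i R else 0) + (if k = i then logDeriv g k j R else 0)
        - (if i = j then g i R / g k R * logDeriv g i k R else 0) := by
  unfold christoffel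
  simp only [inv_diagMetric h0, pd_diagMetric, ite_mul, zero_mul, Finset.sum_ite_eq,
    Finset.mem_univ, if_true, pd_metric h0]
  have := h0 k
  have := h0 i
  split_ifs <;> field_simp <;> ring

theorem christoffel_diag_comm (g : Fin n → (Fin n → ℝ) → ℝ) (k i j : Fin n) (R : Fin n → ℝ) :
    christoffel (diagMetric g) k i j R = christoffel (diagMetric g) k j i R := by
  unfold christoffel
  simp only [pd_diagMetric]
  congr 1
  refine Finset.sum_congr rfl fun l _ => ?_
  by_cases h : i = j
  · subst h; ring
  · simp only [h, Ne.symm h, if_false]; ring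

/-- Metric compatibility in contravariant form: the right-hand side is minus the derivative of the
inverse metric. -/
theorem christoffel_diag_metric (h0 : ∀ i, g i R ≠ 0) (i j k : Fin n) :
    christoffel (diagMetric g) i k j R * (g j R)⁻¹ + christoffel (diagMetric g) j k i R * (g i R)⁻¹
      = if i = j then 2 * (g i R)⁻¹ * logDeriv g i k R else 0 := by
  rw [christoffel_diag h0, christoffel_diag h0]
  have := h0 k
  have := h0 i
  have := h0 j
  by_cases h : i = j
  · subst h
    by_cases h' : i = k
    · subst h'; simp; field_simp; ring
    · simp [h', Ne.symm h']; ring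
  · by_cases h' : i = k
    · subst h'; simp [h, Ne.symm h]; field_simp; ring
    · by_cases h2 : j = k
      · subst h2; simp [h, Ne.symm h]; field_simp; ring
      · simp [h, h', h2, Ne.symm h, Ne.symm h', Ne.symm h2]

theorem curvature_diag (h0 : ∀ i, g i R ≠ 0) (i j k l : Fin n) :
    curvature (diagMetric g) i j k l R = (g j R)⁻¹ * riemann (diagMetric g) i j k l R := by
  unfold curvature
  simp [inv_diagMetric h0]

theorem mixedHess_diag (h0 : ∀ i, g i R ≠ 0) (f : (Fin n → ℝ) → ℝ) (i j : Fin n) :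
    mixedHess (diagMetric g) f i j R = (g i R)⁻¹ *
      (pd i (pd j f) R - ∑ k, christoffel (diagMetric g) k i j R * pd k f R) := by
  unfold mixedHess
  simp [inv_diagMetric h0]

theorem contDiffOn_logDeriv (hU : IsOpen U) (hg : ∀ i, ContDiffOn ℝ ∞ (g i) U)
    (hg0 : ∀ i, ∀ R ∈ U, g i R ≠ 0) (i j : Fin n) : ContDiffOn ℝ ∞ (logDeriv g i j) U :=
  (contDiffOn_pd hU (hg i) j).div (contDiffOn_const.mul (hg i))
    fun R hR => mul_ne_zero two_ne_zero (hg0 i R hR)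

theorem contDiffOn_christoffel (hU : IsOpen U) (hg : ∀ i, ContDiffOn ℝ ∞ (g i) U)
    (hg0 : ∀ i, ∀ R ∈ U, g i R ≠ 0) (k i j : Fin n) :
    ContDiffOn ℝ ∞ (christoffel (diagMetric g) k i j) U := by
  have hl := contDiffOn_logDeriv hU hg hg0
  refine ContDiffOn.congr ?_ fun S hS => christoffel_diag (fun i => hg0 i S hS) k i j
  refine ContDiffOn.sub (ContDiffOn.add ?_ ?_) ?_
  · split_ifs; exacts [hl _ _, contDiffOn_const]
  · split_ifs; exacts [hl _ _, contDiffOn_const]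
  · split_ifs
    exacts [((hg i).div (hg k) (hg0 k)).mul (hl _ _), contDiffOn_const]

theorem contDiffOn_mixedHess (hU : IsOpen U) (hg : ∀ i, ContDiffOn ℝ ∞ (g i) U)
    (hg0 : ∀ i, ∀ R ∈ U, g i R ≠ 0) {f : (Fin n → ℝ) → ℝ} (hf : ContDiffOn ℝ ∞ f U)
    (i j : Fin n) : ContDiffOn ℝ ∞ (mixedHess (diagMetric g) f i j) U := by
  refine ContDiffOn.congr ?_ fun S hS => mixedHess_diag (fun i => hg0 i S hS) f i j
  refine ((hg i).inv (hg0 i)).mul ((contDiffOn_pd hU (contDiffOn_pd hU hf j) i).sub ?_)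
  exact ContDiffOn.sum fun k _ =>
    (contDiffOn_christoffel hU hg hg0 k i j).mul (contDiffOn_pd hU hf k)

/-- The second derivatives of a density which generates a diagonal flow. -/
theorem pd_pd_of_mixedHess (h0 : ∀ i, g i R ≠ 0) {f : (Fin n → ℝ) → ℝ} {w : Fin n → ℝ}
    {i j : Fin n} (hf : mixedHess (diagMetric g) f i j R = if i = j then w i else 0) :
    pd i (pd j f) R = ∑ k, christoffel (diagMetric g) k i j R * pd k f R
      + if i = j then g i R * w i else 0 := by
  rw [mixedHess_diag h0, inv_mul_eq_iff_eq_mul₀ (h0 i)] at hf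
  split_ifs at hf ⊢ <;> linarith

/-- The speeds of a diagonal Hamiltonian flow satisfy the Codazzi equations of the flat metric. -/
theorem codazzi_of_mixedHess (hU : IsOpen U) (hg : ∀ i, ContDiffOn ℝ ∞ (g i) U)
    (hg0 : ∀ i, ∀ R ∈ U, g i R ≠ 0)
    (hflat : ∀ R ∈ U, ∀ i j k l, curvature (diagMetric g) i j k l R = 0)
    {f : (Fin n → ℝ) → ℝ} (hf : ContDiffOn ℝ ∞ f U) {w : Fin n → (Fin n → ℝ) → ℝ}
    (hw : ∀ i, ContDiffOn ℝ ∞ (w i) U)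
    (hfw : ∀ R ∈ U, ∀ i j, mixedHess (diagMetric g) f i j R = if i = j then w i R else 0)
    (hR : R ∈ U) {i j : Fin n} (hij : i ≠ j) :
    pd j (w i) R = logDeriv g i j R * (w j R - w i R) := by
  have h0 : ∀ i, g i R ≠ 0 := fun i => hg0 i R hR
  have hG := contDiffOn_christoffel hU hg hg0
  have dG : ∀ k i j, DifferentiableAt ℝ (christoffel (diagMetric g) k i j) R :=
    fun k i j => differentiableAt_of_mem hU (hG k i j) hR
  have df : ∀ k, DifferentiableAt ℝ (pd k f) R :=
    fun k => differentiableAt_of_mem hU (contDiffOn_pd hU hf k) hR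
  have dg := differentiableAt_of_mem hU (hg i) hR
  have dw := differentiableAt_of_mem hU (hw i) hR
  have hess : ∀ S ∈ U, ∀ i j, pd i (pd j f) S
      = ∑ k, christoffel (diagMetric g) k i j S * pd k f S
        + if i = j then g i S * w i S else 0 := fun S hS i j =>
    pd_pd_of_mixedHess (w := fun i => w i S) (fun i => hg0 i S hS) (hfw S hS i j)
  -- Equality of the mixed third derivatives of `f`, each second derivative being rewritten through
  -- the diagonal Hessian. The terms proportional to first derivatives of `f` assemble into the
  -- Riemann tensor contracted with `df`, which vanishes by `flat`.
  have hcomm := pd_comm hU (contDiffOn_pd hU hf i) hR j i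
  rw [pd_congr hU (fun S hS => hess S hS i i) hR j, pd_congr hU (fun S hS => hess S hS j i) hR i]
    at hcomm
  simp only [if_true, if_neg hij.symm, add_zero] at hcomm
  rw [pd_add (DifferentiableAt.fun_sum fun k _ => (dG k i i).fun_mul (df k)) (dg.fun_mul dw),
    pd_mul dg dw, pd_sum _ fun k _ => (dG k i i).fun_mul (df k),
    pd_sum _ fun k _ => (dG k j i).fun_mul (df k)] at hcomm
  simp only [pd_mul (dG _ _ _) (df _), hess R hR] at hcomm
  have flat : ∀ k, riemann (diagMetric g) k i j i R = 0 := fun k => by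
    have := hflat R hR k i j i
    rw [curvature_diag h0] at this
    simpa [h0 i] using this
  have hsum : ∑ k, riemann (diagMetric g) k i j i R * pd k f R = 0 :=
    Finset.sum_eq_zero fun k _ => by rw [flat, zero_mul]
  unfold riemann at hsum
  simp only [add_mul, sub_mul, Finset.sum_mul, Finset.sum_add_distrib, Finset.sum_sub_distrib,
    mul_add, Finset.mul_sum, mul_ite, mul_zero, Finset.sum_ite_eq, Finset.mem_univ,
    if_true] at hsum hcomm
  rw [Finset.sum_comm (f := fun x y => christoffel (diagMetric g) x j y R * _ * _),
    Finset.sum_comm (f := fun x y => christoffel (diagMetric g) x i y R * _ * _)] at hsum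
  have e1 : ∀ p q : Fin n, ∑ y, ∑ x, christoffel (diagMetric g) x p y R *
      christoffel (diagMetric g) y q i R * pd x f R
      = ∑ x, ∑ y, christoffel (diagMetric g) x q i R *
        (christoffel (diagMetric g) y p x R * pd y f R) := fun p q =>
    Finset.sum_congr rfl fun x _ => Finset.sum_congr rfl fun y _ => by ring
  rw [e1, e1] at hsum
  -- These two symbols multiply the diagonal Hessian entries that survive, `g_j w_j` and `g_i w_i`.
  have c1 : christoffel (diagMetric g) j i i R = - (g i R / g j R * logDeriv g i j R) := by
    rw [christoffel_diag h0]; simp [hij.symm]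
  have c2 : christoffel (diagMetric g) i j i R = logDeriv g i j R := by
    rw [christoffel_diag h0]; simp [hij, hij.symm]
  rw [c1, c2, pd_metric h0] at hcomm
  have e2 : g i R / g j R * logDeriv g i j R * (g j R * w j R)
      = g i R * (logDeriv g i j R * w j R) := by field_simp [h0 j]
  have : g i R * pd j (w i) R = g i R * (logDeriv g i j R * (w j R - w i R)) := by
    linarith
  exact mul_left_cancel₀ (h0 i) this

/-- A common conserved density of diagonal Hamiltonian flows generates a diagonal flow, at the
points where the speeds separate the two directions. -/
theorem mixedHess_eq_zero_of_conserved (hU : IsOpen U) (hg0 : ∀ i, ∀ R ∈ U, g i R ≠ 0)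
    {w : Fin n → (Fin n → ℝ) → ℝ} (hw : ∀ i, ContDiffOn ℝ ∞ (w i) U)
    (hcod : ∀ R ∈ U, ∀ i j, i ≠ j → pd j (w i) R = logDeriv g i j R * (w j R - w i R))
    {a b : (Fin n → ℝ) → ℝ} (ha : ContDiffOn ℝ ∞ a U) (hb : ContDiffOn ℝ ∞ b U)
    (hab : ∀ R ∈ U, ∀ i, pd i b R = w i R * pd i a R)
    (hR : R ∈ U) {i j : Fin n} (hij : i ≠ j) (hne : w i R ≠ w j R) :
    mixedHess (diagMetric g) a i j R = 0 := by
  have h0 : ∀ i, g i R ≠ 0 := fun i => hg0 i R hR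
  have dw := fun i => differentiableAt_of_mem hU (hw i) hR
  have da := fun i => differentiableAt_of_mem hU (contDiffOn_pd hU ha i) hR
  -- The compatibility condition for the flux. After the Codazzi equations are inserted, both sides
  -- differ by `w_i - w_j` times the off-diagonal Hessian of `a`.
  have hcomm := pd_comm hU hb hR i j
  rw [pd_congr hU (fun S hS => hab S hS i) hR j, pd_congr hU (fun S hS => hab S hS j) hR i,
    pd_mul (dw i) (da i), pd_mul (dw j) (da j), hcod R hR i j hij, hcod R hR j i hij.symm,
    pd_comm hU ha hR j i] at hcomm
  rw [mixedHess_diag h0]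
  simp only [christoffel_diag h0, hij, if_false, sub_zero, add_mul, ite_mul, zero_mul,
    Finset.sum_add_distrib, Finset.sum_ite_eq', Finset.mem_univ, if_true]
  have : (w i R - w j R) * (pd i (pd j a) R - (logDeriv g j i R * pd j a R
      + logDeriv g i j R * pd i a R)) = 0 := by linarith
  rw [(mul_eq_zero.1 this).resolve_left (sub_ne_zero.2 hne), mul_zero]

/-- The Codazzi equations `∇_k w^i_j = ∇_j w^i_k` of a diagonal affinor in terms of Christoffel
symbols. -/
theorem codazzi_christoffel (h0 : ∀ i, g i R ≠ 0) {w : Fin n → (Fin n → ℝ) → ℝ}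
    (hcod : ∀ i j, i ≠ j → pd j (w i) R = logDeriv g i j R * (w j R - w i R))
    (i j k : Fin n) :
    (if i = j then pd k (w i) R else 0) + christoffel (diagMetric g) i k j R * w j R
      = (if i = k then pd j (w i) R else 0) + christoffel (diagMetric g) i k j R * w k R := by
  rw [christoffel_diag h0]
  by_cases hij : i = j
  · subst hij
    by_cases hik : i = k
    · subst hik; rfl
    · simp [hik, Ne.symm hik, hcod i k hik]; ring
  · by_cases hik : i = k
    · subst hik; simp [hij, hcod i j hij]; ring
    · by_cases hjk : k = j
      · subst hjk; simp [hij]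
      · simp [hij, hik, hjk]

end DiagonalMetric

/-! ### The rescaled connection and its curvature. -/

section DressedConnection

variable {n : ℕ} {U : Set (Fin n → ℝ)} {g s : Fin n → (Fin n → ℝ) → ℝ}
  {u : Fin n → Fin n → (Fin n → ℝ) → ℝ} {R : Fin n → ℝ}

/-- The connection coefficients of the transformed metric in the frame rescaled to the old
metric. -/
def dressedConn {n : ℕ} (g : Fin n → (Fin n → ℝ) → ℝ) (u : Fin n → Fin n → (Fin n → ℝ) → ℝ)
    (i k j : Fin n) (R : Fin n → ℝ) : ℝ :=
  christoffel (diagMetric g) i k j R - (if i = k then u k j R else 0)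
    + (if k = j then g k R / g i R * u k i R else 0)

theorem logDeriv_mul_sq (h0 : ∀ i, g i R ≠ 0) (hs0 : ∀ i, s i R ≠ 0)
    (dg : ∀ i, DifferentiableAt ℝ (g i) R) (ds : ∀ i, DifferentiableAt ℝ (s i) R) (i j : Fin n) :
    logDeriv (fun i S => g i S * s i S ^ 2) i j R
      = logDeriv g i j R + pd j (s i) R / s i R := by
  unfold logDeriv
  beta_reduce
  have : (fun S => g i S * s i S ^ 2) = fun S => g i S * (s i S * s i S) := by
    funext S; ring
  rw [this, pd_mul (dg i) ((ds i).fun_mul (ds i)), pd_mul (ds i) (ds i)]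
  have := h0 i
  have := hs0 i
  field_simp
  ring

/-- This is the transformation law of a connection under passage to the frame `∂_i / s_i`, in which
the Gram matrix of the new metric is `g`. Off the diagonal the linear system `hlin` eliminates the
derivatives of `s`, so only the gauge term retains them. -/
theorem christoffel_mul_sq (h0 : ∀ i, g i R ≠ 0) (hs0 : ∀ i, s i R ≠ 0)
    (dg : ∀ i, DifferentiableAt ℝ (g i) R) (ds : ∀ i, DifferentiableAt ℝ (s i) R)
    (hlin : ∀ i j, i ≠ j → pd j (s i) R
      = (logDeriv g i j R - u i j R) * s j R - logDeriv g i j R * s i R) (i k j : Fin n) :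
    s i R * christoffel (diagMetric fun i S => g i S * s i S ^ 2) i k j R
      = dressedConn g u i k j R * s j R + if i = j then pd k (s i) R else 0 := by
  have h0' : ∀ i, (fun i S => g i S * s i S ^ 2) i R ≠ 0 := fun i =>
    mul_ne_zero (h0 i) (pow_ne_zero 2 (hs0 i))
  rw [dressedConn, christoffel_diag h0', christoffel_diag h0]
  simp only [logDeriv_mul_sq h0 hs0 dg ds]
  have := h0 i
  have := hs0 i
  have := hs0 k
  by_cases hij : i = j
  · subst hij
    by_cases hik : i = k
    · subst hik; simp; field_simp; ring
    · simp [hik, Ne.symm hik]; field_simp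
  · by_cases hik : i = k
    · subst hik; simp [hij, hlin i j hij]; field_simp; ring
    · by_cases hkj : k = j
      · subst hkj; simp [hij, hlin k i (Ne.symm hij)]; field_simp; ring
      · simp [hij, hik, hkj]

/-- The curvature of a gauge transformed connection. -/
theorem riemann_gauge (hU : IsOpen U) {G : (Fin n → ℝ) → Matrix (Fin n) (Fin n) ℝ}
    {C : Fin n → Fin n → Fin n → (Fin n → ℝ) → ℝ}
    (hs : ∀ i, ContDiffOn ℝ ∞ (s i) U)
    (hG : ∀ k i j, ContDiffOn ℝ ∞ (christoffel G k i j) U)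
    (hC : ∀ k i j, ContDiffOn ℝ ∞ (C k i j) U)
    (hGC : ∀ R ∈ U, ∀ i k j, s i R * christoffel G i k j R
      = C i k j R * s j R + if i = j then pd k (s i) R else 0) (hR : R ∈ U) (i j k l : Fin n) :
    s i R * riemann G i j k l R = (pd k (C i l j) R - pd l (C i k j) R
      + ∑ m, (C i k m R * C m l j R - C i l m R * C m k j R)) * s j R := by
  have ds := fun i => differentiableAt_of_mem hU (hs i) hR
  have dps := fun i k => differentiableAt_of_mem hU (contDiffOn_pd hU (hs i) k) hR
  have dG := fun k i j => differentiableAt_of_mem hU (hG k i j) hR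
  have dC := fun k i j => differentiableAt_of_mem hU (hC k i j) hR
  have key : ∀ k l, pd k (s i) R * christoffel G i l j R + s i R * pd k (christoffel G i l j) R
      = pd k (C i l j) R * s j R + C i l j R * pd k (s j) R
        + if i = j then pd k (pd l (s i)) R else 0 := by
    intro k l
    rw [← pd_mul (ds i) (dG i l j), pd_congr hU (fun S hS => hGC S hS i l j) hR,
      ← pd_mul (dC i l j) (ds j), pd_add ((dC i l j).fun_mul (ds j))]
    · split_ifs <;> simp
    · split_ifs
      exacts [dps i l, differentiableAt_const _]
  have quad : ∀ k l, s i R * ∑ m, christoffel G i k m R * christoffel G m l j R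
      = (∑ m, C i k m R * C m l j R) * s j R + C i k j R * pd l (s j) R
        + pd k (s i) R * christoffel G i l j R := by
    intro k l
    have : ∀ m, s i R * (christoffel G i k m R * christoffel G m l j R)
        = C i k m R * C m l j R * s j R
          + (if m = j then C i k m R * pd l (s m) R else 0)
          + (if i = m then pd k (s i) R * christoffel G m l j R else 0) := by
      intro m
      rw [← mul_assoc, hGC R hR, add_mul, mul_assoc, hGC R hR]
      split_ifs <;> ring
    rw [Finset.mul_sum, Finset.sum_congr rfl fun m _ => this m]
    simp [Finset.sum_add_distrib, Finset.sum_mul]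
  -- The second derivatives of `s` enter only as `δ_ij ∂_k ∂_l s_i`, which is symmetric in `k`, `l`
  -- and drops out. The terms with first derivatives cancel between `key` and `quad` after
  -- antisymmetrization.
  have hss := pd_comm hU (hs i) hR k l
  have k1 := key k l
  have k2 := key l k
  rw [hss] at k1
  unfold riemann
  rw [Finset.sum_sub_distrib, Finset.sum_sub_distrib, mul_add, mul_sub, mul_sub, quad, quad]
  linear_combination k1 - k2

/-- The quadratic part of the curvature of the dressed connection. -/
theorem sum_dressedConn_mul (h0 : ∀ i, g i R ≠ 0) {i j k l : Fin n} (hkl : k ≠ l) :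
    ∑ m, dressedConn g u i k m R * dressedConn g u m l j R
      = ∑ m, christoffel (diagMetric g) i k m R * christoffel (diagMetric g) m l j R
        - christoffel (diagMetric g) i k l R * u l j R
        + (if l = j then g l R / g i R * (2 * logDeriv g i k R * u l i R
            - ∑ m, christoffel (diagMetric g) m k i R * u l m R) else 0)
        - (if i = k then ∑ m, christoffel (diagMetric g) m l j R * u k m R else 0)
        + g k R / g i R * u k i R * christoffel (diagMetric g) k l j R
        + (if i = k then u k l R * u l j R else 0)
        - (if i = k then (if l = j then g l R * ∑ m, (g m R)⁻¹ * u k m R * u l m R else 0) else 0)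
        + (if l = j then g l R / g i R * u k i R * u l k R else 0) := by
  -- Metric compatibility trades the contraction with the inverse metric for one over the upper
  -- index, the form in which Christoffel symbols occur in the derivative of `u`.
  have hm : g i R * ∑ m, christoffel (diagMetric g) i k m R * (g m R)⁻¹ * u l m R
      = 2 * logDeriv g i k R * u l i R
        - ∑ m, christoffel (diagMetric g) m k i R * u l m R := by
    have : ∀ m, g i R * (christoffel (diagMetric g) i k m R * (g m R)⁻¹ * u l m R)
        = (if i = m then 2 * logDeriv g i k R * u l m R else 0)
          - christoffel (diagMetric g) m k i R * u l m R := by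
      intro m
      have := christoffel_diag_metric h0 i m k
      rw [eq_sub_of_add_eq this]
      have := h0 i
      split_ifs
      · field_simp
      · field_simp; ring
    rw [Finset.mul_sum, Finset.sum_congr rfl fun m _ => this m]
    simp
  rw [← hm]
  -- Because `k ≠ l`, the product of the term supported at `m = k` and the term supported at `m = l`
  -- is absent.
  have e : ∀ m, dressedConn g u i k m R * dressedConn g u m l j R
      = christoffel (diagMetric g) i k m R * christoffel (diagMetric g) m l j R
        - (if m = l then christoffel (diagMetric g) i k m R * u l j R else 0)
        + (if l = j then g l R * (christoffel (diagMetric g) i k m R * (g m R)⁻¹ * u l m R) else 0)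
        - (if i = k then christoffel (diagMetric g) m l j R * u k m R else 0)
        + (if k = m then g k R / g i R * u k i R * christoffel (diagMetric g) m l j R else 0)
        + (if i = k then (if m = l then u k m R * u l j R else 0) else 0)
        - (if i = k then (if l = j then g l R * ((g m R)⁻¹ * u k m R * u l m R) else 0) else 0)
        + (if k = m then (if l = j then g l R / g i R * u k i R * u l k R else 0) else 0) := by
    intro m
    unfold dressedConn
    have := h0 i
    have := h0 m
    by_cases hmk : k = m
    · subst hmk
      simp only [hkl, if_true, if_false]
      split_ifs <;> field_simp <;> ring
    · simp only [hmk, if_false]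
      split_ifs <;> field_simp <;> ring
  rw [Finset.sum_congr rfl fun m _ => e m]
  simp only [Finset.sum_add_distrib, Finset.sum_sub_distrib, Finset.sum_ite_eq,
    Finset.sum_ite_eq', Finset.mem_univ, if_true, Finset.sum_ite_irrel, Finset.sum_const_zero,
    ← Finset.mul_sum]
  have := h0 i
  congr 1
  congr 1
  congr 1
  congr 1
  congr 1
  congr 1
  split_ifs
  · field_simp
  · rfl

/-- The connection is the flat one plus a correction whose matrix in direction `k` is `-e_k ⊗ u_k`
plus its `g`-adjoint. The hypothesis `huz` gives the covariant derivative of the covector `u_k` in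
direction `l`: a combination of `u_l` and `u_k`, plus `g_l z_kl dR^l`. The combination cancels
against Christoffel cross terms and part of the quadratic terms. What survives is `z` symmetrized,
from the derivatives, and the inner product of `u_k` and `u_l`, from the product of the corrections.
-/
theorem curvature_dressedConn (hU : IsOpen U) (hg : ∀ i, ContDiffOn ℝ ∞ (g i) U)
    (hg0 : ∀ i, ∀ R ∈ U, g i R ≠ 0)
    (hflat : ∀ R ∈ U, ∀ i j k l, curvature (diagMetric g) i j k l R = 0)
    (hu : ∀ i j, ContDiffOn ℝ ∞ (u i j) U) (hR : R ∈ U) {z : Fin n → Fin n → ℝ}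
    (huz : ∀ k l j, k ≠ l → pd l (u k j) R = (logDeriv g k l R - u k l R) * u l j R
      - logDeriv g k l R * u k j R + ∑ m, christoffel (diagMetric g) m l j R * u k m R
      + if l = j then g l R * z k l else 0) (i j : Fin n) {k l : Fin n} (hkl : k ≠ l) :
    pd k (dressedConn g u i l j) R - pd l (dressedConn g u i k j) R
      + ∑ m, (dressedConn g u i k m R * dressedConn g u m l j R
        - dressedConn g u i l m R * dressedConn g u m k j R)
      = g j R * (z k l + z l k - ∑ m, (g m R)⁻¹ * u k m R * u l m R)
        * ((if i = k then 1 else 0) * (if j = l then 1 else 0)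
          - (if i = l then 1 else 0) * (if j = k then 1 else 0)) := by
  have h0 : ∀ i, g i R ≠ 0 := fun i => hg0 i R hR
  have dg := fun i => differentiableAt_of_mem hU (hg i) hR
  have du := fun i j => differentiableAt_of_mem hU (hu i j) hR
  have dG := fun k i j => differentiableAt_of_mem hU (contDiffOn_christoffel hU hg hg0 k i j) hR
  have flat : riemann (diagMetric g) i j k l R = 0 := by
    have := hflat R hR i j k l
    rw [curvature_diag h0] at this
    simpa [h0 j] using this
  have hpd : ∀ k l, pd k (dressedConn g u i l j) R = pd k (christoffel (diagMetric g) i l j) R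
      - (if i = l then pd k (u l j) R else 0)
      + (if l = j then g l R / g i R * (2 * (logDeriv g l k R - logDeriv g i k R) * u l i R
          + pd k (u l i) R) else 0) := by
    intro k l
    unfold dressedConn
    have dq : DifferentiableAt ℝ (fun S => g l S / g i S) R := by
      simpa only [div_eq_mul_inv] using (dg l).fun_mul ((dg i).fun_inv (h0 i))
    have d1 : DifferentiableAt ℝ (fun S => if i = l then u l j S else 0) R := by
      split_ifs
      exacts [du _ _, differentiableAt_const _]
    have d2 : DifferentiableAt ℝ (fun S => if l = j then g l S / g i S * u l i S else 0) R := by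
      split_ifs
      exacts [dq.fun_mul (du _ _), differentiableAt_const _]
    rw [pd_add ((dG i l j).fun_sub d1) d2, pd_sub (dG i l j) d1]
    have := h0 i
    congr 1
    · congr 1
      split_ifs <;> simp
    · split_ifs
      · rw [pd_mul dq (du _ _), pd_div (dg l) (dg i) (h0 i), pd_metric h0, pd_metric h0]
        field_simp
      · simp
  unfold riemann at flat
  rw [Finset.sum_sub_distrib] at flat ⊢
  rw [hpd, hpd, sum_dressedConn_mul h0 hkl, sum_dressedConn_mul h0 hkl.symm,
    huz l k j hkl.symm, huz k l j hkl, huz l k i hkl.symm, huz k l i hkl]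
  have c1 : christoffel (diagMetric g) i k l R
      = (if i = l then logDeriv g i k R else 0) + (if i = k then logDeriv g i l R else 0) := by
    rw [christoffel_diag h0]; simp [hkl]
  have c1' : christoffel (diagMetric g) i l k R
      = (if i = l then logDeriv g i k R else 0) + (if i = k then logDeriv g i l R else 0) := by
    rw [christoffel_diag_comm, c1]
  have c2 : christoffel (diagMetric g) k l j R
      = (if k = j then logDeriv g k l R else 0)
        - (if l = j then g l R / g k R * logDeriv g l k R else 0) := by
    rw [christoffel_diag h0]; simp [hkl]
  have c3 : christoffel (diagMetric g) l k j R
      = (if l = j then logDeriv g l k R else 0)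
        - (if k = j then g k R / g l R * logDeriv g k l R else 0) := by
    rw [christoffel_diag h0]; simp [hkl.symm]
  rw [c1, c1', c2, c3]
  have hD : ∑ m, (g m R)⁻¹ * u l m R * u k m R = ∑ m, (g m R)⁻¹ * u k m R * u l m R :=
    Finset.sum_congr rfl fun m _ => by ring
  rw [hD]
  generalize ∑ m, (g m R)⁻¹ * u k m R * u l m R = D
  rw [sub_add_sub_comm] at flat
  have hi := h0 i
  have hk := h0 k
  have hl := h0 l
  -- For each pattern of coincidences among the indices the identity is a multiple of `flat`; the
  -- factors of `g` come from clearing denominators.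
  by_cases hik : i = k
  · subst hik
    by_cases hjl : j = l
    · subst hjl
      simp only [hkl, hkl.symm, if_true, if_false]
      field_simp
      linear_combination (g i R) * flat
    · by_cases hjk : j = i
      · subst hjk
        simp only [hkl, hkl.symm, if_true, if_false]
        field_simp
        linear_combination (g j R) * flat
      · simp only [hkl, hjl, hjk, Ne.symm hjl, Ne.symm hjk, if_true, if_false]
        linear_combination flat
  · by_cases hil : i = l
    · subst hil
      by_cases hjl : j = i
      · subst hjl
        simp only [hkl, hkl.symm, if_true, if_false]
        field_simp
        linear_combination (g j R) * flat
      · by_cases hjk : j = k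
        · subst hjk
          simp only [hkl, hkl.symm, if_true, if_false]
          field_simp
          linear_combination (g i R) * flat
        · simp only [hkl, hkl.symm, hjl, hjk, Ne.symm hjl, Ne.symm hjk, if_true, if_false]
          linear_combination flat
    · by_cases hjl : j = l
      · subst hjl
        simp only [hkl, hkl.symm, hik, hil, Ne.symm hik, if_true, if_false]
        field_simp
        linear_combination (g i R) * flat
      · by_cases hjk : j = k
        · subst hjk
          simp only [hkl, hkl.symm, hik, hil, Ne.symm hil, if_true, if_false]
          field_simp
          linear_combination (g i R) * flat
        · simp only [hik, hil, hjl, hjk, Ne.symm hjl, Ne.symm hjk, if_false]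
          linear_combination flat

end DressedConnection

/-! ### Smoothness and derivatives of the inverse matrix. -/

section InverseMatrix

variable {n N : ℕ} {U : Set (Fin n → ℝ)} {a : Fin N → Fin N → (Fin n → ℝ) → ℝ}

theorem contDiffOn_det {M : Fin N → Fin N → (Fin n → ℝ) → ℝ}
    (hM : ∀ i j, ContDiffOn ℝ ∞ (M i j) U) :
    ContDiffOn ℝ ∞ (fun R => (Matrix.of fun i j => M i j R).det) U := by
  simp only [Matrix.det_apply']
  exact ContDiffOn.sum fun σ _ => contDiffOn_const.mul (contDiffOn_prod fun i _ => hM _ _)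

theorem contDiffOn_invMat (ha : ∀ γ β, ContDiffOn ℝ ∞ (a γ β) U)
    (hdet : ∀ R ∈ U, IsUnit (Matrix.of fun γ β => a γ β R).det) (ν γ : Fin N) :
    ContDiffOn ℝ ∞ (invMat a ν γ) U := by
  have hadj : ContDiffOn ℝ ∞ (fun R => (Matrix.of fun γ' β => a γ' β R).adjugate ν γ) U := by
    simp only [Matrix.adjugate_apply]
    -- Cramer's rule: an entry of the adjugate is the determinant of the matrix with one row
    -- replaced by a unit vector.
    refine (contDiffOn_det (M := fun i j R =>
      if i = γ then (Pi.single ν 1 : Fin N → ℝ) j else a i j R) fun i j => ?_).congr fun R _ => ?_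
    · split_ifs
      exacts [contDiffOn_const, ha i j]
    · congr 1
      ext i j
      simp [Matrix.updateRow_apply]
  refine ((contDiffOn_det ha).inv fun R hR => (hdet R hR).ne_zero).mul hadj |>.congr fun R _ => ?_
  simp [invMat, Matrix.inv_def]

theorem sum_invMat_mul {R : Fin n → ℝ} (hdet : IsUnit (Matrix.of fun γ β => a γ β R).det)
    (ν β : Fin N) : ∑ γ, invMat a ν γ R * a γ β R = if ν = β then 1 else 0 := by
  have := congrFun (congrFun (Matrix.nonsing_inv_mul _ hdet) ν) β
  rwa [Matrix.mul_apply, Matrix.one_apply] at this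

theorem sum_mul_invMat {R : Fin n → ℝ} (hdet : IsUnit (Matrix.of fun γ β => a γ β R).det)
    (γ δ : Fin N) : ∑ β, a γ β R * invMat a β δ R = if γ = δ then 1 else 0 := by
  have := congrFun (congrFun (Matrix.mul_nonsing_inv _ hdet) γ) δ
  rwa [Matrix.mul_apply, Matrix.one_apply] at this

/-- Differentiating `A a = 1` and multiplying on the right by `A` gives `∂A = -A (∂a) A`. -/
theorem pd_invMat (hU : IsOpen U) (ha : ∀ γ β, ContDiffOn ℝ ∞ (a γ β) U)
    (hdet : ∀ R ∈ U, IsUnit (Matrix.of fun γ β => a γ β R).det) {R : Fin n → ℝ} (hR : R ∈ U)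
    (ν δ : Fin N) (j : Fin n) :
    pd j (invMat a ν δ) R
      = - ∑ γ, ∑ β, invMat a ν γ R * pd j (a γ β) R * invMat a β δ R := by
  have da := fun γ β => differentiableAt_of_mem hU (ha γ β) hR
  have dA := fun ν γ => differentiableAt_of_mem hU (contDiffOn_invMat ha hdet ν γ) hR
  have h1 : ∀ β, ∑ γ, pd j (invMat a ν γ) R * a γ β R
      = - ∑ γ, invMat a ν γ R * pd j (a γ β) R := by
    intro β
    have := pd_congr hU (fun S hS => sum_invMat_mul (hdet S hS) ν β) hR j
    rw [pd_const, pd_sum _ fun γ _ => (dA ν γ).fun_mul (da γ β)] at this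
    simp only [pd_mul (dA _ _) (da _ _), Finset.sum_add_distrib] at this
    linarith
  have h2 : ∑ β, (∑ γ, pd j (invMat a ν γ) R * a γ β R) * invMat a β δ R
      = pd j (invMat a ν δ) R := by
    simp only [Finset.sum_mul, mul_assoc]
    rw [Finset.sum_comm]
    simp only [← Finset.mul_sum, sum_mul_invMat (hdet R hR)]
    simp
  rw [← h2]
  simp only [h1, neg_mul, Finset.sum_neg_distrib, Finset.sum_mul]
  rw [Finset.sum_comm]

end InverseMatrix

/-! ### The linear system of the reciprocal transformation and the curvature of the transformed
metric. -/

/-- Commuting diagonal flows which are Hamiltonian with respect to a flat diagonal metric,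
together with conserved densities `a γ 0` which generate diagonal Hamiltonian flows. -/
structure ReciprocalSetup {n N : ℕ} [NeZero N] (U : Set (Fin n → ℝ))
    (g : Fin n → (Fin n → ℝ) → ℝ) (v : Fin N → Fin n → (Fin n → ℝ) → ℝ)
    (a c : Fin N → Fin N → (Fin n → ℝ) → ℝ) : Prop where
  isOpen : IsOpen U
  contDiffOn_metric : ∀ i, ContDiffOn ℝ ∞ (g i) U
  metric_ne_zero : ∀ i, ∀ R ∈ U, g i R ≠ 0
  flat : ∀ R ∈ U, ∀ i j k l, curvature (diagMetric g) i j k l R = 0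
  contDiffOn_speed : ∀ β i, ContDiffOn ℝ ∞ (v β i) U
  codazzi_speed : ∀ β, ∀ R ∈ U, ∀ i j, i ≠ j →
    pd j (v β i) R = logDeriv g i j R * (v β j R - v β i R)
  contDiffOn_flux : ∀ γ β, ContDiffOn ℝ ∞ (a γ β) U
  pd_flux : ∀ γ β, ∀ R ∈ U, ∀ i, pd i (a γ β) R = v β i R * pd i (a γ 0) R
  isUnit_det : ∀ R ∈ U, IsUnit (Matrix.of fun γ β => a γ β R).det
  speedSum_ne_zero : ∀ R ∈ U, ∀ i, speedSum a v 0 i R ≠ 0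
  mixedHess_density : ∀ γ, ∀ R ∈ U, ∀ i j,
    mixedHess (diagMetric g) (a γ 0) i j R = if i = j then extraSpeed g a γ i R else 0
  contDiffOn_extraFlux : ∀ γ β, ContDiffOn ℝ ∞ (c γ β) U
  pd_extraFlux : ∀ γ β, ∀ R ∈ U, ∀ i,
    pd i (c γ β) R = extraSpeed g a β i R * pd i (a γ 0) R
  extraFlux_add : ∀ γ β, ∀ R ∈ U,
    c γ β R + c β γ R = ∑ k, (g k R)⁻¹ * pd k (a β 0) R * pd k (a γ 0) R

/-- The coefficients `∑_ε s^i_ε ∂_j a^ε` of the dressing of the connection, with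
`s = speedSum`. -/
def dressing {n N : ℕ} [NeZero N] (a : Fin N → Fin N → (Fin n → ℝ) → ℝ)
    (v : Fin N → Fin n → (Fin n → ℝ) → ℝ) (i j : Fin n) (R : Fin n → ℝ) : ℝ :=
  ∑ ε, speedSum a v ε i R * pd j (a ε 0) R

/-- The numerators of the transformed speeds `newExtraSpeed`. -/
def shiftedExtraSpeed {n N : ℕ} [NeZero N] (g : Fin n → (Fin n → ℝ) → ℝ)
    (a c : Fin N → Fin N → (Fin n → ℝ) → ℝ) (v : Fin N → Fin n → (Fin n → ℝ) → ℝ)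
    (γ : Fin N) (i : Fin n) (R : Fin n → ℝ) : ℝ :=
  extraSpeed g a γ i R - ∑ β, c β γ R * speedSum a v β i R

namespace ReciprocalSetup

variable {n N : ℕ} [NeZero N] {U : Set (Fin n → ℝ)} {g : Fin n → (Fin n → ℝ) → ℝ}
  {v : Fin N → Fin n → (Fin n → ℝ) → ℝ} {a c : Fin N → Fin N → (Fin n → ℝ) → ℝ}
  {R : Fin n → ℝ}

theorem contDiffOn_speedSum (H : ReciprocalSetup U g v a c) (β : Fin N) (i : Fin n) :
    ContDiffOn ℝ ∞ (speedSum a v β i) U :=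
  ContDiffOn.sum fun γ _ =>
    (contDiffOn_invMat H.contDiffOn_flux H.isUnit_det γ β).mul (H.contDiffOn_speed γ i)

theorem contDiffOn_extraSpeed (H : ReciprocalSetup U g v a c) (γ : Fin N) (i : Fin n) :
    ContDiffOn ℝ ∞ (extraSpeed g a γ i) U :=
  contDiffOn_mixedHess H.isOpen H.contDiffOn_metric H.metric_ne_zero (H.contDiffOn_flux γ 0) i i

theorem contDiffOn_shiftedExtraSpeed (H : ReciprocalSetup U g v a c) (γ : Fin N) (i : Fin n) :
    ContDiffOn ℝ ∞ (shiftedExtraSpeed g a c v γ i) U :=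
  (H.contDiffOn_extraSpeed γ i).sub <| ContDiffOn.sum fun β _ =>
    (H.contDiffOn_extraFlux β γ).mul (H.contDiffOn_speedSum β i)

theorem contDiffOn_dressing (H : ReciprocalSetup U g v a c) (i j : Fin n) :
    ContDiffOn ℝ ∞ (dressing a v i j) U :=
  ContDiffOn.sum fun ε _ =>
    (H.contDiffOn_speedSum ε i).mul (contDiffOn_pd H.isOpen (H.contDiffOn_flux ε 0) j)

theorem contDiffOn_newMetric (H : ReciprocalSetup U g v a c) (i : Fin n) :
    ContDiffOn ℝ ∞ (newMetric g a v i) U :=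
  (H.contDiffOn_metric i).mul ((H.contDiffOn_speedSum 0 i).pow 2)

theorem newMetric_ne_zero (H : ReciprocalSetup U g v a c) (i : Fin n) :
    ∀ R ∈ U, newMetric g a v i R ≠ 0 := fun R hR =>
  mul_ne_zero (H.metric_ne_zero i R hR) (pow_ne_zero 2 (H.speedSum_ne_zero R hR i))

theorem contDiffOn_newSpeed (H : ReciprocalSetup U g v a c) (β : Fin N) (i : Fin n) :
    ContDiffOn ℝ ∞ (newSpeed a v β i) U :=
  (H.contDiffOn_speedSum β i).div (H.contDiffOn_speedSum 0 i)
    fun R hR => H.speedSum_ne_zero R hR i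

theorem contDiffOn_newExtraSpeed (H : ReciprocalSetup U g v a c) (β : Fin N) (i : Fin n) :
    ContDiffOn ℝ ∞ (newExtraSpeed g a c v β i) U :=
  (H.contDiffOn_shiftedExtraSpeed β i).div (H.contDiffOn_speedSum 0 i)
    fun R hR => H.speedSum_ne_zero R hR i

theorem codazzi_extraSpeed (H : ReciprocalSetup U g v a c) (hR : R ∈ U) (γ : Fin N)
    {i j : Fin n} (hij : i ≠ j) :
    pd j (extraSpeed g a γ i) R
      = logDeriv g i j R * (extraSpeed g a γ j R - extraSpeed g a γ i R) :=
  codazzi_of_mixedHess H.isOpen H.contDiffOn_metric H.metric_ne_zero H.flat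
    (H.contDiffOn_flux γ 0) (H.contDiffOn_extraSpeed γ) (H.mixedHess_density γ) hR hij

/-- In `∂A = -A (∂a) A` the conservation laws `∂_j a^ε_δ = v^j_δ ∂_j a^ε_1` make `∂_j A^γ_β` a
product of a factor depending on `γ` and the factor `s^j_β`; contracting with `v` yields the
dressing term. The Codazzi equations of `v` supply the rest. The coefficients are the same for all
`β`. -/
theorem pd_speedSum (H : ReciprocalSetup U g v a c) (hR : R ∈ U) (β : Fin N)
    {i j : Fin n} (hij : i ≠ j) :
    pd j (speedSum a v β i) R
      = (logDeriv g i j R - dressing a v i j R) * speedSum a v β j R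
        - logDeriv g i j R * speedSum a v β i R := by
  have dA := fun ν γ => differentiableAt_of_mem H.isOpen
    (contDiffOn_invMat H.contDiffOn_flux H.isUnit_det ν γ) hR
  have dv := fun γ => differentiableAt_of_mem H.isOpen (H.contDiffOn_speed γ i) hR
  have hA : ∀ γ, pd j (invMat a γ β) R
      = - ((∑ ε, invMat a γ ε R * pd j (a ε 0) R) * speedSum a v β j R) := by
    intro γ
    rw [pd_invMat H.isOpen H.contDiffOn_flux H.isUnit_det hR, speedSum, Finset.sum_mul_sum]
    congr 1
    refine Finset.sum_congr rfl fun ε _ => Finset.sum_congr rfl fun δ _ => ?_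
    rw [H.pd_flux ε δ R hR j]
    ring
  have hd : dressing a v i j R = ∑ γ, (∑ ε, invMat a γ ε R * pd j (a ε 0) R) * v γ i R := by
    simp only [dressing, speedSum, Finset.sum_mul]
    rw [Finset.sum_comm]
    exact Finset.sum_congr rfl fun ε _ => Finset.sum_congr rfl fun δ _ => by ring
  rw [hd]
  have : speedSum a v β i = fun S => ∑ γ, invMat a γ β S * v γ i S := rfl
  rw [this, pd_sum _ fun γ _ => (dA γ β).fun_mul (dv γ)]
  simp only [pd_mul (dA _ _) (dv _), hA, H.codazzi_speed _ R hR i j hij]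
  have e1 : speedSum a v β j R = ∑ γ, invMat a γ β R * v γ j R := rfl
  have : ∀ γ, -((∑ ε, invMat a γ ε R * pd j (a ε 0) R) * speedSum a v β j R) * v γ i R
        + invMat a γ β R * (logDeriv g i j R * (v γ j R - v γ i R))
      = - (((∑ ε, invMat a γ ε R * pd j (a ε 0) R) * v γ i R) * speedSum a v β j R)
        + logDeriv g i j R * (invMat a γ β R * v γ j R)
        - logDeriv g i j R * (invMat a γ β R * v γ i R) := fun γ => by ring
  rw [Finset.sum_congr rfl fun γ _ => this γ]
  simp only [Finset.sum_add_distrib, Finset.sum_sub_distrib, Finset.sum_neg_distrib,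
    ← Finset.mul_sum, ← Finset.sum_mul, ← e1]
  ring

/-- The Codazzi equations of `w` lack only the dressing term. The derivative `∂_j c^β_γ = w^j_γ ∂_j
a^β_1` of the shift produces it, and the remaining part of the shift is a combination of solutions
of the linear system. This is the reason for subtracting `c^β_γ s^i_β`. -/
theorem pd_shiftedExtraSpeed (H : ReciprocalSetup U g v a c) (hR : R ∈ U) (γ : Fin N)
    {i j : Fin n} (hij : i ≠ j) :
    pd j (shiftedExtraSpeed g a c v γ i) R
      = (logDeriv g i j R - dressing a v i j R) * shiftedExtraSpeed g a c v γ j R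
        - logDeriv g i j R * shiftedExtraSpeed g a c v γ i R := by
  have ds := fun β => differentiableAt_of_mem H.isOpen (H.contDiffOn_speedSum β i) hR
  have dc := fun β => differentiableAt_of_mem H.isOpen (H.contDiffOn_extraFlux β γ) hR
  have dw := differentiableAt_of_mem H.isOpen (H.contDiffOn_extraSpeed γ i) hR
  have : shiftedExtraSpeed g a c v γ i
    = fun S => extraSpeed g a γ i S - ∑ β, c β γ S * speedSum a v β i S := rfl
  rw [this, pd_sub dw (DifferentiableAt.fun_sum fun β _ => (dc β).fun_mul (ds β)),
    pd_sum _ fun β _ => (dc β).fun_mul (ds β), H.codazzi_extraSpeed hR γ hij]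
  simp only [pd_mul (dc _) (ds _), H.pd_speedSum hR _ hij, H.pd_extraFlux _ _ R hR]
  have : ∀ β, extraSpeed g a γ j R * pd j (a β 0) R * speedSum a v β i R
      + c β γ R * ((logDeriv g i j R - dressing a v i j R) * speedSum a v β j R
        - logDeriv g i j R * speedSum a v β i R)
      = extraSpeed g a γ j R * (speedSum a v β i R * pd j (a β 0) R)
        + (logDeriv g i j R - dressing a v i j R) * (c β γ R * speedSum a v β j R)
        - logDeriv g i j R * (c β γ R * speedSum a v β i R) := fun β => by ring
  rw [Finset.sum_congr rfl fun β _ => this β]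
  simp only [Finset.sum_add_distrib, Finset.sum_sub_distrib, ← Finset.mul_sum]
  have e : ∀ i, shiftedExtraSpeed g a c v γ i R
    = extraSpeed g a γ i R - ∑ β, c β γ R * speedSum a v β i R := fun _ => rfl
  rw [← dressing, e]
  ring

theorem logDeriv_newMetric (H : ReciprocalSetup U g v a c) (hR : R ∈ U) {i j : Fin n}
    (hij : i ≠ j) :
    logDeriv (newMetric g a v) i j R = (logDeriv g i j R - dressing a v i j R)
      * speedSum a v 0 j R / speedSum a v 0 i R := by
  have := logDeriv_mul_sq (s := speedSum a v 0) (fun i => H.metric_ne_zero i R hR)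
    (H.speedSum_ne_zero R hR)
    (fun i => differentiableAt_of_mem H.isOpen (H.contDiffOn_metric i) hR)
    (fun i => differentiableAt_of_mem H.isOpen (H.contDiffOn_speedSum 0 i) hR) i j
  rw [show newMetric g a v = fun i S => g i S * speedSum a v 0 i S ^ 2 from rfl, this,
    H.pd_speedSum hR 0 hij]
  have := H.speedSum_ne_zero R hR i
  field_simp
  ring

/-- Numerator and denominator solve the same linear system, so the terms `-Γ_ij y_i` cancel in the
quotient rule; the remaining coefficient `(Γ_ij - u_ij) s_j / s_i` is the logarithmic derivative of
the new metric. -/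
theorem codazzi_div (H : ReciprocalSetup U g v a c) (hR : R ∈ U)
    {y : Fin n → (Fin n → ℝ) → ℝ} (hy : ∀ i, ContDiffOn ℝ ∞ (y i) U) {i j : Fin n} (hij : i ≠ j)
    (hlin : pd j (y i) R = (logDeriv g i j R - dressing a v i j R) * y j R
      - logDeriv g i j R * y i R) :
    pd j (fun S => y i S / speedSum a v 0 i S) R
      = logDeriv (newMetric g a v) i j R
        * (y j R / speedSum a v 0 j R - y i R / speedSum a v 0 i R) := by
  rw [pd_div (differentiableAt_of_mem H.isOpen (hy i) hR)
    (differentiableAt_of_mem H.isOpen (H.contDiffOn_speedSum 0 i) hR)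
    (H.speedSum_ne_zero R hR i), hlin, H.pd_speedSum hR 0 hij, H.logDeriv_newMetric hR hij]
  have := H.speedSum_ne_zero R hR i
  have := H.speedSum_ne_zero R hR j
  field_simp
  ring

theorem codazzi_newSpeed (H : ReciprocalSetup U g v a c) (hR : R ∈ U) (β : Fin N) {i j : Fin n}
    (hij : i ≠ j) :
    pd j (newSpeed a v β i) R = logDeriv (newMetric g a v) i j R
      * (newSpeed a v β j R - newSpeed a v β i R) :=
  H.codazzi_div hR (H.contDiffOn_speedSum β) hij (H.pd_speedSum hR β hij)

theorem codazzi_newExtraSpeed (H : ReciprocalSetup U g v a c) (hR : R ∈ U) (β : Fin N)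
    {i j : Fin n} (hij : i ≠ j) :
    pd j (newExtraSpeed g a c v β i) R = logDeriv (newMetric g a v) i j R
      * (newExtraSpeed g a c v β j R - newExtraSpeed g a c v β i R) :=
  H.codazzi_div hR (H.contDiffOn_shiftedExtraSpeed β) hij (H.pd_shiftedExtraSpeed hR β hij)

/-- The hypothesis on `u` in `curvature_dressedConn`, with `z_kl = ∑_ε s^k_ε w^l_ε`. The linear
system gives the first terms; the diagonal Hessians of the densities give the Christoffel sum and
the term at `l = j`. -/
theorem pd_dressing (H : ReciprocalSetup U g v a c) (hR : R ∈ U) {k l : Fin n} (j : Fin n)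
    (hkl : k ≠ l) :
    pd l (dressing a v k j) R
      = (logDeriv g k l R - dressing a v k l R) * dressing a v l j R
        - logDeriv g k l R * dressing a v k j R
        + ∑ m, christoffel (diagMetric g) m l j R * dressing a v k m R
        + if l = j then g l R * ∑ ε, speedSum a v ε k R * extraSpeed g a ε l R else 0 := by
  have ds := fun β => differentiableAt_of_mem H.isOpen (H.contDiffOn_speedSum β k) hR
  have da := fun ε => differentiableAt_of_mem H.isOpen
    (contDiffOn_pd H.isOpen (H.contDiffOn_flux ε 0) j) hR
  have : dressing a v k j = fun S => ∑ ε, speedSum a v ε k S * pd j (a ε 0) S := rfl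
  rw [this, pd_sum _ fun ε _ => (ds ε).fun_mul (da ε)]
  simp only [pd_mul (ds _) (da _), H.pd_speedSum hR _ hkl]
  have hess : ∀ ε, pd l (pd j (a ε 0)) R
      = ∑ m, christoffel (diagMetric g) m l j R * pd m (a ε 0) R
        + if l = j then g l R * extraSpeed g a ε l R else 0 := fun ε =>
    pd_pd_of_mixedHess (w := fun i => extraSpeed g a ε i R)
      (fun i => H.metric_ne_zero i R hR) (H.mixedHess_density ε R hR l j)
  simp only [hess]
  have e1 : ∑ m, christoffel (diagMetric g) m l j R * dressing a v k m R
      = ∑ ε, speedSum a v ε k R * ∑ m, christoffel (diagMetric g) m l j R * pd m (a ε 0) R := by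
    simp only [dressing, Finset.mul_sum]
    rw [Finset.sum_comm]
    exact Finset.sum_congr rfl fun ε _ => Finset.sum_congr rfl fun δ _ => by ring
  have e2 : (if l = j then g l R * ∑ ε, speedSum a v ε k R * extraSpeed g a ε l R else 0)
      = ∑ ε, speedSum a v ε k R * if l = j then g l R * extraSpeed g a ε l R else 0 := by
    split_ifs
    · rw [Finset.mul_sum]
      exact Finset.sum_congr rfl fun ε _ => by ring
    · simp
  have e3 : dressing a v l j R = ∑ ε, speedSum a v ε l R * pd j (a ε 0) R := rfl
  rw [e1, e2, e3, Finset.mul_sum, Finset.mul_sum, ← Finset.sum_sub_distrib,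
    ← Finset.sum_add_distrib, ← Finset.sum_add_distrib]
  exact Finset.sum_congr rfl fun ε _ => by ring

/-- By the normalization of the fluxes, the inner product of the covectors `u_k` and `u_l` is `∑
s^k_ε s^l_δ (c^ε_δ + c^δ_ε)`, precisely the effect of replacing `w` by its shifted version in both
sums. The normalization is used only here. -/
theorem sum_speedSum_mul_shiftedExtraSpeed (H : ReciprocalSetup U g v a c) (hR : R ∈ U)
    (k l : Fin n) :
    ∑ ε, speedSum a v ε k R * extraSpeed g a ε l R + ∑ ε, speedSum a v ε l R * extraSpeed g a ε k R
        - ∑ m, (g m R)⁻¹ * dressing a v k m R * dressing a v l m R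
      = ∑ ε, (speedSum a v ε k R * shiftedExtraSpeed g a c v ε l R
        + speedSum a v ε l R * shiftedExtraSpeed g a c v ε k R) := by
  have e1 : ∑ m, (g m R)⁻¹ * dressing a v k m R * dressing a v l m R
      = ∑ ε, ∑ δ, speedSum a v ε k R * speedSum a v δ l R * (c ε δ R + c δ ε R) := by
    simp only [H.extraFlux_add _ _ R hR, dressing, Finset.mul_sum, Finset.sum_mul]
    rw [Finset.sum_comm]
    simp only [Finset.sum_comm (s := (Finset.univ : Finset (Fin n)))]
    rw [Finset.sum_comm]
    exact Finset.sum_congr rfl fun ε _ => Finset.sum_congr rfl fun δ _ =>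
      Finset.sum_congr rfl fun m _ => by ring
  have e2 : ∑ ε, ∑ δ, speedSum a v ε k R * speedSum a v δ l R * c ε δ R
      = ∑ ε, speedSum a v ε l R * ∑ β, c β ε R * speedSum a v β k R := by
    simp only [Finset.mul_sum]
    rw [Finset.sum_comm]
    exact Finset.sum_congr rfl fun ε _ => Finset.sum_congr rfl fun δ _ => by ring
  have e3 : ∑ ε, ∑ δ, speedSum a v ε k R * speedSum a v δ l R * c δ ε R
      = ∑ ε, speedSum a v ε k R * ∑ β, c β ε R * speedSum a v β l R := by
    simp only [Finset.mul_sum]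
    exact Finset.sum_congr rfl fun ε _ => Finset.sum_congr rfl fun δ _ => by ring
  simp only [e1, mul_add, Finset.sum_add_distrib, e2, e3, shiftedExtraSpeed, mul_sub,
    Finset.sum_sub_distrib]
  ring

theorem curvature_newMetric (H : ReciprocalSetup U g v a c) (hR : R ∈ U) (i j k l : Fin n) :
    curvature (diagMetric (newMetric g a v)) i j k l R
      = (∑ β, (newSpeed a v β i R * newExtraSpeed g a c v β j R
          + newSpeed a v β j R * newExtraSpeed g a c v β i R))
        * ((if i = k then 1 else 0) * (if j = l then 1 else 0)
          - (if i = l then 1 else 0) * (if j = k then 1 else 0)) := by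
  rw [curvature_diag fun i => H.newMetric_ne_zero i R hR]
  by_cases hkl : k = l
  · subst hkl
    simp only [riemann, sub_self, Finset.sum_const_zero, add_zero, mul_zero]
  have hs := H.speedSum_ne_zero R hR
  have hC : ∀ i k j, ContDiffOn ℝ ∞ (dressedConn g (dressing a v) i k j) U := by
    intro i k j
    refine ((contDiffOn_christoffel H.isOpen H.contDiffOn_metric H.metric_ne_zero i k j).sub
      ?_).add ?_
    · split_ifs
      exacts [H.contDiffOn_dressing _ _, contDiffOn_const]
    · split_ifs
      exacts [((H.contDiffOn_metric k).div (H.contDiffOn_metric i) (H.metric_ne_zero i)).mul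
        (H.contDiffOn_dressing _ _), contDiffOn_const]
  have gauge := riemann_gauge H.isOpen (G := diagMetric (newMetric g a v)) (s := speedSum a v 0)
    (C := dressedConn g (dressing a v)) (H.contDiffOn_speedSum 0)
    (contDiffOn_christoffel H.isOpen H.contDiffOn_newMetric H.newMetric_ne_zero) hC
    (fun S hS i k j => christoffel_mul_sq (fun i => H.metric_ne_zero i S hS)
      (H.speedSum_ne_zero S hS)
      (fun i => differentiableAt_of_mem H.isOpen (H.contDiffOn_metric i) hS)
      (fun i => differentiableAt_of_mem H.isOpen (H.contDiffOn_speedSum 0 i) hS)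
      (fun i j hij => H.pd_speedSum hS 0 hij) i k j) hR i j k l
  rw [curvature_dressedConn H.isOpen H.contDiffOn_metric H.metric_ne_zero H.flat
    H.contDiffOn_dressing hR
    (z := fun k l => ∑ ε, speedSum a v ε k R * extraSpeed g a ε l R)
    (fun k l j hkl => H.pd_dressing hR j hkl) i j hkl,
    H.sum_speedSum_mul_shiftedExtraSpeed hR] at gauge
  have hg := H.metric_ne_zero j R hR
  have si := hs i
  have sj := hs j
  have e : ∑ β, (newSpeed a v β i R * newExtraSpeed g a c v β j R
          + newSpeed a v β j R * newExtraSpeed g a c v β i R)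
      = (∑ β, (speedSum a v β i R * shiftedExtraSpeed g a c v β j R
        + speedSum a v β j R * shiftedExtraSpeed g a c v β i R))
          / (speedSum a v 0 i R * speedSum a v 0 j R) := by
    rw [Finset.sum_div]
    refine Finset.sum_congr rfl fun β _ => ?_
    have e : ∀ i, newExtraSpeed g a c v β i R
      = shiftedExtraSpeed g a c v β i R / speedSum a v 0 i R := fun _ => rfl
    rw [e, e, newSpeed, newSpeed]
    field_simp
  -- Raising the index and undoing the gauge leaves the factor `g_j s_j / (g_j s_j² s_i) = 1 / (s_i
  -- s_j)`, which turns the numerators into the transformed speeds.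
  rw [e, newMetric, ← mul_right_inj' si, ← mul_assoc, mul_comm (speedSum a v 0 i R) (_)⁻¹,
    mul_assoc, gauge]
  by_cases hik : i = k
  · by_cases hjl : j = l
    · subst hik hjl
      simp only [if_true, if_neg hkl]
      field_simp
    · subst hik
      simp [hjl, hkl]
  · by_cases hil : i = l
    · by_cases hjk : j = k
      · subst hil hjk
        simp only [if_true, if_neg hik]
        simp only [add_comm (speedSum a v _ j R * _)]
        field_simp
      · simp [hik, hjk]
    · simp [hik, hil]

end ReciprocalSetup

open MeasureTheory Set

/-! ### The skew-symmetric antiderivative. -/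

section SkewAntiderivative

variable {f k : ℝ → ℝ} {a b : ℝ}

theorem integral_eq_intervalIntegral (hf : ∀ x, x ∉ Ioo a b → f x = 0) :
    ∫ x, f x = ∫ x in a..b, f x := by
  symm
  apply intervalIntegral.integral_eq_integral_of_support_subset
  intro x hx
  by_contra h
  exact hx (hf x fun h' => h (Ioo_subset_Ioc_self h'))

theorem integrable_of_eq_zero (hc : ContinuousOn f (Icc a b))
    (hf : ∀ x, x ∉ Ioo a b → f x = 0) : Integrable f := by
  have h1 : IntegrableOn f (Icc a b) := hc.integrableOn_Icc
  refine h1.integrable_of_forall_notMem_eq_zero fun x hx => hf x fun h => hx (Ioo_subset_Icc_self h)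

/-- Continuity is required only on `[a, b]`: a perturbed field may leave `U` elsewhere, where the
integrand vanishes anyway. -/
theorem invD_eq_intervalIntegral (hc : ContinuousOn f (Icc a b))
    (hf : ∀ x, x ∉ Ioo a b → f x = 0) (x : ℝ) :
    invD f x = (∫ y in a..x, f y) - (1 / 2 : ℝ) * ∫ y in a..b, f y := by
  have hi := integrable_of_eq_zero hc hf
  have h1 : ∫ y in Iic x, f y = ∫ y in a..x, f y := by
    rw [← intervalIntegral.integral_Iic_sub_Iic hi.integrableOn hi.integrableOn]
    rw [setIntegral_eq_zero_of_forall_eq_zero (t := Iic a) fun y hy => hf y fun h => ?_, sub_zero]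
    exact absurd h.1 (not_lt.2 hy)
  have h2 : (∫ y in Iic x, f y) + ∫ y in Ioi x, f y = ∫ y in a..b, f y := by
    rw [intervalIntegral.integral_Iic_add_Ioi hi.integrableOn hi.integrableOn,
      integral_eq_intervalIntegral hf]
  unfold invD
  linarith

theorem exists_Ioo_of_hasCompactSupport {E : Type*} [Zero E] {f : ℝ → E}
    (hf : HasCompactSupport f) : ∃ r > 0, ∀ x, x ∉ Ioo (-r) r → f x = 0 := by
  obtain ⟨r, hr⟩ := hf.isBounded.subset_ball 0
  refine ⟨max r 1, by positivity, fun x hx => ?_⟩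
  by_contra h
  have := hr (subset_tsupport f h)
  rw [mem_ball_zero_iff, Real.norm_eq_abs, abs_lt] at this
  exact hx ⟨by linarith [le_max_left r 1], by linarith [le_max_left r 1]⟩

theorem hasDerivAt_invD (hf : Continuous f) (hs : HasCompactSupport f) (x : ℝ) :
    HasDerivAt (invD f) (f x) x := by
  obtain ⟨r, hr, h⟩ := exists_Ioo_of_hasCompactSupport hs
  have : invD f = fun x => (∫ y in (-r)..x, f y) - (1 / 2 : ℝ) * ∫ y in (-r)..r, f y :=
    funext fun x => invD_eq_intervalIntegral hf.continuousOn h x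
  rw [this]
  exact (intervalIntegral.integral_hasDerivAt_right (hf.intervalIntegrable _ _)
    (hf.stronglyMeasurableAtFilter _ _) hf.continuousAt).sub_const _

theorem contDiff_invD (hf : ContDiff ℝ ∞ f) (hs : HasCompactSupport f) :
    ContDiff ℝ ∞ (invD f) := by
  have h := hasDerivAt_invD hf.continuous hs
  rw [contDiff_infty_iff_deriv]
  refine ⟨fun x => (h x).differentiableAt, ?_⟩
  rwa [show deriv (invD f) = f from funext fun x => (h x).deriv]

theorem integral_deriv_eq_zero_of_hasCompactSupport {f' : ℝ → ℝ} (hf : ∀ x, HasDerivAt f (f' x) x)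
    (hc : Continuous f') (hs : HasCompactSupport f) : ∫ x, f' x = 0 := by
  have he : f' = deriv f := funext fun x => (hf x).deriv.symm
  have hs' : HasCompactSupport f' := he ▸ hs.deriv
  exact integral_eq_zero_of_hasDerivAt_of_integrable hf (hc.integrable_of_hasCompactSupport hs')
    ((continuous_iff_continuousAt.2 fun x => (hf x).continuousAt).integrable_of_hasCompactSupport
      hs)

/-- `invD` is skew-symmetric. -/
theorem integral_mul_invD (hf : Continuous f) (hfs : HasCompactSupport f) (hk : Continuous k)
    (hks : HasCompactSupport k) :
    ∫ x, f x * invD k x = - ∫ x, k x * invD f x := by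
  obtain ⟨r, hr, h⟩ := exists_Ioo_of_hasCompactSupport hfs
  obtain ⟨s, hs, h'⟩ := exists_Ioo_of_hasCompactSupport hks
  have hrs : ∀ x, x ∉ Ioo (-(max r s)) (max r s) → f x = 0 ∧ k x = 0 := fun x hx =>
    ⟨h x fun hx' => hx ⟨by linarith [le_max_left r s, hx'.1], by linarith [le_max_left r s, hx'.2]⟩,
      h' x fun hx' => hx
        ⟨by linarith [le_max_right r s, hx'.1], by linarith [le_max_right r s, hx'.2]⟩⟩
  set t := max r s
  have ht : -t ≤ t := by have := le_max_left r s; linarith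
  have hdf := hasDerivAt_invD hf hfs
  have hdk := hasDerivAt_invD hk hks
  have cf : Continuous (invD f) := continuous_iff_continuousAt.2 fun x => (hdf x).continuousAt
  have ck : Continuous (invD k) := continuous_iff_continuousAt.2 fun x => (hdk x).continuousAt
  rw [integral_eq_intervalIntegral fun x hx => by rw [(hrs x hx).1, zero_mul],
    integral_eq_intervalIntegral fun x hx => by rw [(hrs x hx).2, zero_mul],
    eq_neg_iff_add_eq_zero, ← intervalIntegral.integral_add
      (f := fun x => f x * invD k x) (g := fun x => k x * invD f x) ((hf.mul ck).intervalIntegrable _ _) ((hk.mul cf).intervalIntegrable _ _)]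
  -- The integrand is the derivative of `invD f * invD k`. Each factor takes opposite values at `-t`
  -- and `t`, namely minus and plus half of the total integral, so the boundary values of the
  -- product agree.
  rw [intervalIntegral.integral_eq_sub_of_hasDerivAt (f := fun x => invD f x * invD k x)
    (f' := fun x => f x * invD k x + k x * invD f x)
    (fun x _ => ((hdf x).mul (hdk x)).congr_deriv (by ring))
    (((hf.mul ck).add (hk.mul cf)).intervalIntegrable _ _)]
  simp only [invD_eq_intervalIntegral hf.continuousOn fun x hx => (hrs x hx).1,
    invD_eq_intervalIntegral hk.continuousOn fun x hx => (hrs x hx).2,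
    intervalIntegral.integral_same]
  ring

end SkewAntiderivative

/-! ### Integrals depending on a parameter. -/

section Families

/-- A family `f ε` of functions on `[a, b]`, continuous, with a continuous derivative `f'` with
respect to the parameter `ε ∈ [-δ, δ]`. -/
structure IsC1Family (δ a b : ℝ) (f f' : ℝ → ℝ → ℝ) : Prop where
  continuousOn : ContinuousOn (fun p : ℝ × ℝ => f p.1 p.2) (Icc (-δ) δ ×ˢ Icc a b)
  continuousOn_deriv : ContinuousOn (fun p : ℝ × ℝ => f' p.1 p.2) (Icc (-δ) δ ×ˢ Icc a b)
  hasDerivAt : ∀ ε ∈ Ioo (-δ) δ, ∀ x ∈ Icc a b, HasDerivAt (fun e => f e x) (f' ε x) ε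

namespace IsC1Family

variable {δ a b : ℝ} {f f' k k' : ℝ → ℝ → ℝ}

theorem continuousOn_slice (hf : IsC1Family δ a b f f') {ε : ℝ} (hε : ε ∈ Icc (-δ) δ) :
    ContinuousOn (f ε) (Icc a b) :=
  hf.continuousOn.comp (f := fun x => (ε, x)) (by fun_prop) fun _ hx => ⟨hε, hx⟩

theorem const {φ : ℝ → ℝ} (hφ : ContinuousOn φ (Icc a b)) :
    IsC1Family δ a b (fun _ => φ) (fun _ _ => 0) :=
  ⟨hφ.comp continuousOn_snd fun _ hp => hp.2, continuousOn_const,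
    fun ε _ x _ => hasDerivAt_const ε (φ x)⟩

theorem add (hf : IsC1Family δ a b f f') (hk : IsC1Family δ a b k k') :
    IsC1Family δ a b (fun ε x => f ε x + k ε x) (fun ε x => f' ε x + k' ε x) :=
  ⟨hf.continuousOn.add hk.continuousOn, hf.continuousOn_deriv.add hk.continuousOn_deriv,
    fun ε hε x hx => (hf.hasDerivAt ε hε x hx).add (hk.hasDerivAt ε hε x hx)⟩

theorem sub (hf : IsC1Family δ a b f f') (hk : IsC1Family δ a b k k') :
    IsC1Family δ a b (fun ε x => f ε x - k ε x) (fun ε x => f' ε x - k' ε x) :=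
  ⟨hf.continuousOn.sub hk.continuousOn, hf.continuousOn_deriv.sub hk.continuousOn_deriv,
    fun ε hε x hx => (hf.hasDerivAt ε hε x hx).sub (hk.hasDerivAt ε hε x hx)⟩

theorem mul (hf : IsC1Family δ a b f f') (hk : IsC1Family δ a b k k') :
    IsC1Family δ a b (fun ε x => f ε x * k ε x)
      (fun ε x => f' ε x * k ε x + f ε x * k' ε x) :=
  ⟨hf.continuousOn.mul hk.continuousOn,
    (hf.continuousOn_deriv.mul hk.continuousOn).add (hf.continuousOn.mul hk.continuousOn_deriv),
    fun ε hε x hx => (hf.hasDerivAt ε hε x hx).mul (hk.hasDerivAt ε hε x hx)⟩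

theorem sum {ι : Type*} (s : Finset ι) {F F' : ι → ℝ → ℝ → ℝ}
    (hF : ∀ i, IsC1Family δ a b (F i) (F' i)) :
    IsC1Family δ a b (fun ε x => ∑ i ∈ s, F i ε x) (fun ε x => ∑ i ∈ s, F' i ε x) :=
  ⟨continuousOn_finsetSum _ fun i _ => (hF i).continuousOn,
    continuousOn_finsetSum _ fun i _ => (hF i).continuousOn_deriv,
    fun ε hε x hx => HasDerivAt.fun_sum fun i _ => (hF i).hasDerivAt ε hε x hx⟩

theorem continuousOn_integral (hδ : 0 ≤ δ) (hab : a ≤ b)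
    (hf : ContinuousOn (fun p : ℝ × ℝ => f p.1 p.2) (Icc (-δ) δ ×ˢ Icc a b)) :
    ContinuousOn (fun p : ℝ × ℝ => ∫ y in a..p.2, f p.1 y) (Icc (-δ) δ ×ˢ Icc a b) := by
  have hδ' : -δ ≤ δ := by linarith
  -- Projecting both variables to their intervals extends the integrand to a continuous function on
  -- the whole plane without changing the integral.
  have hc : Continuous fun p : ℝ × ℝ => f (projIcc (-δ) δ hδ' p.1) (projIcc a b hab p.2) :=
    hf.comp_continuous (f := fun p : ℝ × ℝ =>
      (((projIcc (-δ) δ hδ' p.1 : ℝ), (projIcc a b hab p.2 : ℝ)) : ℝ × ℝ))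
      (by fun_prop) fun p => ⟨Subtype.coe_prop _, Subtype.coe_prop _⟩
  have h2 : Continuous fun p : ℝ × ℝ =>
      ∫ y in a..p.2, f (projIcc (-δ) δ hδ' p.1) (projIcc a b hab y) := by
    apply intervalIntegral.continuous_parametric_intervalIntegral_of_continuous
      (f := fun (p : ℝ × ℝ) y => f (projIcc (-δ) δ hδ' p.1) (projIcc a b hab y))
    · exact hc.comp (by fun_prop : Continuous fun q : (ℝ × ℝ) × ℝ => (q.1.1, q.2))
    · fun_prop
  refine h2.continuousOn.congr fun p hp => intervalIntegral.integral_congr fun y hy => ?_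
  rw [uIcc_of_le hp.2.1] at hy
  simp only [projIcc_of_mem hδ' hp.1, projIcc_of_mem hab (⟨hy.1, hy.2.trans hp.2.2⟩ : y ∈ Icc a b)]

theorem hasDerivAt_integral (hf : IsC1Family δ a b f f') {ε x : ℝ} (hε : ε ∈ Ioo (-δ) δ)
    (hx : x ∈ Icc a b) :
    HasDerivAt (fun e => ∫ y in a..x, f e y) (∫ y in a..x, f' ε y) ε := by
  -- On the compact rectangle the parameter derivative is bounded, so a constant serves as the
  -- dominating function.
  obtain ⟨M, hM⟩ := (isCompact_Icc.prod isCompact_Icc).exists_bound_of_continuousOn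
    hf.continuousOn_deriv
  have hsub : ∀ y ∈ uIoc a x, y ∈ Icc a b := fun y hy => by
    rw [uIoc_of_le hx.1] at hy
    exact ⟨hy.1.le, hy.2.trans hx.2⟩
  have hsub' : uIcc a x ⊆ Icc a b := by
    rw [uIcc_of_le hx.1]; exact Icc_subset_Icc_right hx.2
  have hslice' : ContinuousOn (f' ε) (Icc a b) :=
    hf.continuousOn_deriv.comp (f := fun x => (ε, x)) (by fun_prop)
      fun _ hx => ⟨Ioo_subset_Icc_self hε, hx⟩
  refine (intervalIntegral.hasDerivAt_integral_of_dominated_loc_of_deriv_le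
    (s := Ioo (-δ) δ) (bound := fun _ => M) (Ioo_mem_nhds hε.1 hε.2) ?_ ?_ ?_ ?_ ?_ ?_).2
  · filter_upwards [Ioo_mem_nhds hε.1 hε.2] with e he
    exact (((hf.continuousOn_slice (Ioo_subset_Icc_self he)).mono hsub').intervalIntegrable
      (μ := volume)).aestronglyMeasurable_restrict_uIoc
  · exact ((hf.continuousOn_slice (Ioo_subset_Icc_self hε)).mono hsub').intervalIntegrable
  · exact ((hslice'.mono hsub').intervalIntegrable (μ := volume)).aestronglyMeasurable_restrict_uIoc
  · exact Filter.Eventually.of_forall fun y hy e he =>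
      hM (e, y) ⟨Ioo_subset_Icc_self he, hsub y hy⟩
  · exact intervalIntegrable_const
  · exact Filter.Eventually.of_forall fun y hy e he => hf.hasDerivAt e he y (hsub y hy)

theorem integral (hf : IsC1Family δ a b f f') (hδ : 0 ≤ δ) (hab : a ≤ b) :
    IsC1Family δ a b (fun ε x => ∫ y in a..x, f ε y) (fun ε x => ∫ y in a..x, f' ε y) :=
  ⟨continuousOn_integral hδ hab hf.continuousOn,
    continuousOn_integral hδ hab hf.continuousOn_deriv,
    fun _ hε _ hx => hf.hasDerivAt_integral hε hx⟩

theorem total (hf : IsC1Family δ a b f f') (hδ : 0 ≤ δ) (hab : a ≤ b) :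
    IsC1Family δ a b (fun ε _ => ∫ y in a..b, f ε y) (fun ε _ => ∫ y in a..b, f' ε y) := by
  have h := hf.integral hδ hab
  have hm : MapsTo (fun p : ℝ × ℝ => (p.1, b)) (Icc (-δ) δ ×ˢ Icc a b) (Icc (-δ) δ ×ˢ Icc a b) :=
    fun p hp => ⟨hp.1, right_mem_Icc.2 hab⟩
  exact ⟨h.continuousOn.comp (f := fun p : ℝ × ℝ => (p.1, b)) (by fun_prop) hm,
    h.continuousOn_deriv.comp (f := fun p : ℝ × ℝ => (p.1, b)) (by fun_prop) hm,
    fun ε hε _ _ => h.hasDerivAt ε hε b (right_mem_Icc.2 hab)⟩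

/-- The nonlocal primitive on `[a, b]` of a family. -/
theorem skewIntegral (hf : IsC1Family δ a b f f') (hδ : 0 ≤ δ) (hab : a ≤ b) :
    IsC1Family δ a b (fun ε x => (∫ y in a..x, f ε y) - (1 / 2 : ℝ) * ∫ y in a..b, f ε y)
      (fun ε x => (∫ y in a..x, f' ε y) - (1 / 2 : ℝ) * ∫ y in a..b, f' ε y) := by
  have h := (hf.integral hδ hab).sub ((const (δ := δ) (a := a) (b := b)
    (φ := fun _ => (1 / 2 : ℝ)) continuousOn_const).mul (hf.total hδ hab))
  simpa only [zero_mul, zero_add] using h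

end IsC1Family

end Families

/-! ### Nonlocal operators of hydrodynamic type. -/

section HydroOperators

variable {n : ℕ} {A : Type*} [Fintype A]

/-- A metric with contravariant components `q i` on the diagonal, a torsion free metric connection
`Γ` and diagonal affinors `W α`, such that the Gauss and Codazzi equations hold. -/
structure HydroStructure (U : Set (Fin n → ℝ)) (q : Fin n → (Fin n → ℝ) → ℝ)
    (Γ : Fin n → Fin n → Fin n → (Fin n → ℝ) → ℝ) (W : A → Fin n → (Fin n → ℝ) → ℝ)
    (σ : A → A) : Prop where
  isOpen : IsOpen U
  involutive : Function.Involutive σ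
  contDiffOn_metric : ∀ i, ContDiffOn ℝ ∞ (q i) U
  contDiffOn_conn : ∀ i j k, ContDiffOn ℝ ∞ (Γ i j k) U
  contDiffOn_affinor : ∀ α i, ContDiffOn ℝ ∞ (W α i) U
  symm : ∀ R ∈ U, ∀ i j k, Γ i j k R = Γ i k j R
  metric : ∀ R ∈ U, ∀ i j k,
    (if i = j then pd k (q i) R else 0) + Γ i k j R * q j R + Γ j k i R * q i R = 0
  codazzi : ∀ α, ∀ R ∈ U, ∀ i j k,
    (if i = j then pd k (W α i) R else 0) + Γ i k j R * W α j R
      = (if i = k then pd j (W α i) R else 0) + Γ i k j R * W α k R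
  gauss : ∀ R ∈ U, ∀ i j k l,
    q j R * (pd k (Γ i l j) R - pd l (Γ i k j) R
        + ∑ m, (Γ i k m R * Γ m l j R - Γ i l m R * Γ m k j R))
      = (∑ α, W α i R * W (σ α) j R) * ((if i = k then 1 else 0) * (if j = l then 1 else 0)
          - (if i = l then 1 else 0) * (if j = k then 1 else 0))

/-- The velocity of a field. -/
def vel (R : ℝ → Fin n → ℝ) (x : ℝ) (i : Fin n) : ℝ := deriv (fun y => R y i) x

/-- The matrix `w^k Γ^j_{ki}` of the connection in the direction `w`. -/
def conn (Γ : Fin n → Fin n → Fin n → (Fin n → ℝ) → ℝ) (S w : Fin n → ℝ) (j i : Fin n) : ℝ :=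
  ∑ k, w k * Γ j k i S

/-- The derivative of `conn Γ S w` with respect to `S` in the direction `u`. -/
def dconn (Γ : Fin n → Fin n → Fin n → (Fin n → ℝ) → ℝ) (S u w : Fin n → ℝ) (j i : Fin n) : ℝ :=
  ∑ k, w k * fderiv ℝ (Γ j k i) S u

/-- The covariant derivative of a covector field along a field. -/
def covD (Γ : Fin n → Fin n → Fin n → (Fin n → ℝ) → ℝ) (R ξ : ℝ → Fin n → ℝ) (x : ℝ)
    (i : Fin n) : ℝ :=
  vel ξ x i - ∑ j, conn Γ (R x) (vel R x) j i * ξ x j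

/-- The covariant variation, in the direction `V`, of a covector field with constant components. -/
def covVar (Γ : Fin n → Fin n → Fin n → (Fin n → ℝ) → ℝ) (R V ξ : ℝ → Fin n → ℝ) (x : ℝ)
    (i : Fin n) : ℝ :=
  - ∑ j, conn Γ (R x) (V x) j i * ξ x j

/-- The pairing of the vector field `W_α V` with a covector field. -/
def pairing (W : A → Fin n → (Fin n → ℝ) → ℝ) (R V : ℝ → Fin n → ℝ) (α : A)
    (ξ : ℝ → Fin n → ℝ) (x : ℝ) : ℝ :=
  ∑ j, W α j (R x) * V x j * ξ x j

/-- The variation of `pairing W R (vel R)` in the direction `V`. -/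
def varPairing (W : A → Fin n → (Fin n → ℝ) → ℝ) (R V : ℝ → Fin n → ℝ) (α : A)
    (ξ : ℝ → Fin n → ℝ) (x : ℝ) : ℝ :=
  ∑ j, (fderiv ℝ (W α j) (R x) (V x) * vel R x j + W α j (R x) * vel V x j) * ξ x j

/-- The nonlocal factor of a hydrodynamic operator. -/
def tail (W : A → Fin n → (Fin n → ℝ) → ℝ) (σ : A → A) (R ξ : ℝ → Fin n → ℝ) (x : ℝ)
    (i : Fin n) : ℝ :=
  ∑ α, W α i (R x) * invD (pairing W R (vel R) (σ α) ξ) x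

/-- The operator `q^i D_i + ∑_α W_α R_x (d/dx)⁻¹ W_{σ α} R_x`. -/
def hydroOp (q : Fin n → (Fin n → ℝ) → ℝ) (Γ : Fin n → Fin n → Fin n → (Fin n → ℝ) → ℝ)
    (W : A → Fin n → (Fin n → ℝ) → ℝ) (σ : A → A) (R ξ : ℝ → Fin n → ℝ) (x : ℝ)
    (i : Fin n) : ℝ :=
  q i (R x) * covD Γ R ξ x i + vel R x i * tail W σ R ξ x i

/-- The local part of the bracket density. -/
def localDensity (q : Fin n → (Fin n → ℝ) → ℝ) (Γ : Fin n → Fin n → Fin n → (Fin n → ℝ) → ℝ)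
    (R ξ η : ℝ → Fin n → ℝ) (x : ℝ) : ℝ :=
  ∑ i, ξ x i * (q i (R x) * covD Γ R η x i)

/-- The variation of the local part of the bracket density. -/
def varLocalDensity (q : Fin n → (Fin n → ℝ) → ℝ)
    (Γ : Fin n → Fin n → Fin n → (Fin n → ℝ) → ℝ) (R V ξ η : ℝ → Fin n → ℝ) (x : ℝ) : ℝ :=
  ∑ i, ξ x i * (fderiv ℝ (q i) (R x) (V x) * covD Γ R η x i
    - q i (R x) * ∑ j, (dconn Γ (R x) (V x) (vel R x) j i + conn Γ (R x) (vel V x) j i) * η x j)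

end HydroOperators

/-! ### Smoothness and derivatives along a field. -/

section Curves

variable {n : ℕ} {U : Set (Fin n → ℝ)} {f : (Fin n → ℝ) → ℝ} {R V ξ : ℝ → Fin n → ℝ}

theorem hasDerivAt_vel (hR : ContDiff ℝ ∞ R) (x : ℝ) : HasDerivAt R (vel R x) x := by
  rw [hasDerivAt_pi]
  intro i
  exact ((contDiff_pi.1 hR i).differentiable (by simp) x).hasDerivAt

theorem contDiff_vel (hR : ContDiff ℝ ∞ R) : ContDiff ℝ ∞ (vel R) :=
  contDiff_pi.2 fun i => (contDiff_infty_iff_deriv.1 (contDiff_pi.1 hR i)).2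

theorem contDiff_comp_curve (hf : ContDiffOn ℝ ∞ f U) (hR : ContDiff ℝ ∞ R)
    (hRU : ∀ x, R x ∈ U) : ContDiff ℝ ∞ fun x => f (R x) :=
  hf.comp_contDiff hR hRU

theorem hasDerivAt_comp_curve (hU : IsOpen U) (hf : ContDiffOn ℝ ∞ f U) (hR : ContDiff ℝ ∞ R)
    (hRU : ∀ x, R x ∈ U) (x : ℝ) :
    HasDerivAt (fun y => f (R y)) (fderiv ℝ f (R x) (vel R x)) x :=
  (differentiableAt_of_mem hU hf (hRU x)).hasFDerivAt.comp_hasDerivAt x (hasDerivAt_vel hR x)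

theorem contDiff_fderiv_curve (hU : IsOpen U) (hf : ContDiffOn ℝ ∞ f U) (hR : ContDiff ℝ ∞ R)
    (hRU : ∀ x, R x ∈ U) (hV : ContDiff ℝ ∞ V) :
    ContDiff ℝ ∞ fun x => fderiv ℝ f (R x) (V x) :=
  ((hf.fderiv_of_isOpen hU (m := ∞) (by simp)).comp_contDiff hR hRU).clm_apply hV

theorem hasDerivAt_apply (hV : ContDiff ℝ ∞ V) (x : ℝ) (i : Fin n) :
    HasDerivAt (fun y => V y i) (vel V x i) x :=
  hasDerivAt_pi.1 (hasDerivAt_vel hV x) i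

theorem contDiff_apply_curve (hV : ContDiff ℝ ∞ V) (i : Fin n) : ContDiff ℝ ∞ fun x => V x i :=
  contDiff_pi.1 hV i

theorem hasCompactSupport_of_eq_zero (hξ : HasCompactSupport ξ) {E : Type*} [Zero E] {φ : ℝ → E}
    (h : ∀ x, ξ x = 0 → φ x = 0) : HasCompactSupport φ :=
  hξ.mono fun x hx hx' => hx (h x hx')

end Curves

/-! ### The structure equations contracted with vectors. -/

namespace HydroStructure

variable {n : ℕ} {A : Type*} [Fintype A] {U : Set (Fin n → ℝ)} {q : Fin n → (Fin n → ℝ) → ℝ}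
  {Γ : Fin n → Fin n → Fin n → (Fin n → ℝ) → ℝ} {W : A → Fin n → (Fin n → ℝ) → ℝ}
  {σ : A → A} {R V ξ η ζ : ℝ → Fin n → ℝ}

theorem conn_symm (H : HydroStructure U q Γ W σ) {S : Fin n → ℝ} (hS : S ∈ U) (u w : Fin n → ℝ)
    (j : Fin n) : ∑ i, conn Γ S u j i * w i = ∑ i, conn Γ S w j i * u i := by
  simp only [conn, Finset.sum_mul]
  rw [Finset.sum_comm]
  refine Finset.sum_congr rfl fun i _ => Finset.sum_congr rfl fun k _ => ?_
  rw [H.symm S hS j i k]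
  ring

theorem conn_metric (H : HydroStructure U q Γ W σ) {S : Fin n → ℝ} (hS : S ∈ U) (w : Fin n → ℝ)
    (i j : Fin n) : (if i = j then fderiv ℝ (q i) S w else 0) + conn Γ S w i j * q j S
      + conn Γ S w j i * q i S = 0 := by
  have : ∑ k, w k * ((if i = j then pd k (q i) S else 0) + Γ i k j S * q j S
      + Γ j k i S * q i S) = 0 :=
    Finset.sum_eq_zero fun k _ => by rw [H.metric S hS, mul_zero]
  refine Eq.trans ?_ this
  rw [fderiv_eq_sum_pd]
  simp only [conn, Finset.sum_mul, mul_add, Finset.sum_add_distrib, mul_assoc]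
  congr 2
  split_ifs
  · exact Finset.sum_congr rfl fun k _ => mul_comm _ _
  · simp

theorem conn_codazzi (H : HydroStructure U q Γ W σ) {S : Fin n → ℝ} (hS : S ∈ U)
    (u w : Fin n → ℝ) (α : A) (j : Fin n) :
    fderiv ℝ (W α j) S u * w j + ∑ i, conn Γ S u j i * (W α i S * w i)
      = fderiv ℝ (W α j) S w * u j + ∑ i, conn Γ S w j i * (W α i S * u i) := by
  have h : ∑ i, ∑ k, u k * w i * ((if j = i then pd k (W α j) S else 0) + Γ j k i S * W α i S)
      = ∑ i, ∑ k, u k * w i * ((if j = k then pd i (W α j) S else 0) + Γ j k i S * W α k S) :=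
    Finset.sum_congr rfl fun i _ => Finset.sum_congr rfl fun k _ => by rw [H.codazzi α S hS]
  simp only [mul_add, Finset.sum_add_distrib] at h
  rw [fderiv_eq_sum_pd, fderiv_eq_sum_pd]
  convert h using 2
  · rw [Finset.sum_comm]
    simp only [mul_ite, mul_zero, Finset.sum_ite_eq, Finset.mem_univ, if_true, Finset.sum_mul]
    exact Finset.sum_congr rfl fun k _ => by ring
  · simp only [conn, Finset.sum_mul]
    exact Finset.sum_congr rfl fun i _ => Finset.sum_congr rfl fun k _ => by ring
  · simp only [mul_ite, mul_zero, Finset.sum_ite_eq, Finset.mem_univ, if_true, Finset.sum_mul]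
    exact Finset.sum_congr rfl fun k _ => by ring
  · simp only [conn, Finset.sum_mul]
    rw [Finset.sum_comm]
    refine Finset.sum_congr rfl fun i _ => Finset.sum_congr rfl fun k _ => ?_
    rw [H.symm S hS]
    ring

theorem conn_gauss (H : HydroStructure U q Γ W σ) {S : Fin n → ℝ} (hS : S ∈ U)
    (u w : Fin n → ℝ) (m i : Fin n) :
    q i S * (dconn Γ S u w m i - dconn Γ S w u m i
        + ∑ j, (conn Γ S u m j * conn Γ S w j i - conn Γ S w m j * conn Γ S u j i))
      = ∑ α, W α m S * W (σ α) i S * (u m * w i - w m * u i) := by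
  have h : ∑ p, ∑ k, u p * w k * (q i S * (pd p (Γ m k i) S - pd k (Γ m p i) S
        + ∑ j, (Γ m p j S * Γ j k i S - Γ m k j S * Γ j p i S)))
      = ∑ p, ∑ k, u p * w k * ((∑ α, W α m S * W (σ α) i S) *
        ((if m = p then 1 else 0) * (if i = k then 1 else 0)
          - (if m = k then 1 else 0) * (if i = p then 1 else 0))) :=
    Finset.sum_congr rfl fun p _ => Finset.sum_congr rfl fun k _ => by rw [H.gauss S hS]
  have e1 : ∀ u w : Fin n → ℝ, ∑ p, ∑ k, u p * w k * pd p (Γ m k i) S = dconn Γ S u w m i := by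
    intro u w
    simp only [dconn, fderiv_eq_sum_pd, Finset.mul_sum]
    rw [Finset.sum_comm]
    exact Finset.sum_congr rfl fun i _ => Finset.sum_congr rfl fun k _ => by ring
  have e2 : ∀ u w : Fin n → ℝ, ∑ p, ∑ k, u p * w k * ∑ j, Γ m p j S * Γ j k i S
      = ∑ j, conn Γ S u m j * conn Γ S w j i := by
    intro u w
    simp only [conn, Finset.sum_mul_sum]
    simp only [Finset.mul_sum]
    rw [Finset.sum_comm' (t' := Finset.univ) (s' := fun _ => Finset.univ) (by simp)]
    rw [Finset.sum_comm]
    conv_rhs => rw [Finset.sum_comm]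
    refine Finset.sum_congr rfl fun p _ => ?_
    rw [Finset.sum_comm]
    exact Finset.sum_congr rfl fun i _ => Finset.sum_congr rfl fun k _ => by ring
  have e1' : ∑ p, ∑ k, u p * w k * pd k (Γ m p i) S = dconn Γ S w u m i := by
    rw [← e1, Finset.sum_comm]
    exact Finset.sum_congr rfl fun i _ => Finset.sum_congr rfl fun k _ => by ring
  have e2' : ∑ p, ∑ k, u p * w k * ∑ j, Γ m k j S * Γ j p i S
      = ∑ j, conn Γ S w m j * conn Γ S u j i := by
    rw [← e2, Finset.sum_comm]
    exact Finset.sum_congr rfl fun i _ => Finset.sum_congr rfl fun k _ => by ring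
  have l : ∑ p, ∑ k, u p * w k * (q i S * (pd p (Γ m k i) S - pd k (Γ m p i) S
        + ∑ j, (Γ m p j S * Γ j k i S - Γ m k j S * Γ j p i S)))
      = q i S * (dconn Γ S u w m i - dconn Γ S w u m i
        + ∑ j, (conn Γ S u m j * conn Γ S w j i - conn Γ S w m j * conn Γ S u j i)) := by
    rw [Finset.sum_sub_distrib, ← e1, ← e1', ← e2, ← e2']
    simp only [mul_add, mul_sub, Finset.sum_add_distrib, Finset.sum_sub_distrib, Finset.mul_sum]
    simp only [← mul_assoc, mul_comm _ (q i S)]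
  rw [← l, h]
  simp only [mul_sub, Finset.sum_sub_distrib, ← mul_assoc, mul_ite, mul_one, mul_zero,
    Finset.sum_ite_eq, Finset.mem_univ, if_true, Finset.sum_ite_irrel, Finset.sum_const_zero]
  simp only [← Finset.sum_mul]
  ring

end HydroStructure

theorem isTest_apply {n : ℕ} {ξ : ℝ → Fin n → ℝ} (hξ : IsTest ξ) (i : Fin n) :
    ContDiff ℝ ∞ fun x => ξ x i := contDiff_pi.1 hξ.1 i

section

variable {n : ℕ} {A : Type*} {q : Fin n → (Fin n → ℝ) → ℝ}
  {Γ : Fin n → Fin n → Fin n → (Fin n → ℝ) → ℝ} {W : A → Fin n → (Fin n → ℝ) → ℝ}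
  {σ : A → A} {R V ξ η : ℝ → Fin n → ℝ} {x : ℝ}

theorem pairing_eq_zero {α : A} (h : ξ x = 0) : pairing W R V α ξ x = 0 := by
  simp [pairing, h]

theorem varPairing_eq_zero {α : A} (h : ξ x = 0) : varPairing W R V α ξ x = 0 := by
  simp [varPairing, h]

theorem localDensity_eq_zero (h : ξ x = 0) : localDensity q Γ R ξ η x = 0 := by
  simp [localDensity, h]

theorem varLocalDensity_eq_zero (h : ξ x = 0) : varLocalDensity q Γ R V ξ η x = 0 := by
  simp [varLocalDensity, h]

theorem sum_mul_hydroOp [Fintype A] (ξ η : ℝ → Fin n → ℝ) (x : ℝ) :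
    ∑ i, ξ x i * hydroOp q Γ W σ R η x i = localDensity q Γ R ξ η x
      + ∑ α, pairing W R (vel R) α ξ x * invD (pairing W R (vel R) (σ α) η) x := by
  simp only [hydroOp, localDensity, pairing, tail, mul_add, Finset.sum_add_distrib,
    Finset.mul_sum, Finset.sum_mul]
  congr 1
  rw [Finset.sum_comm]
  exact Finset.sum_congr rfl fun i _ => Finset.sum_congr rfl fun k _ => by ring

end

/-! ### Smoothness of the ingredients of the bracket, and their pointwise variations. -/

namespace HydroStructure

variable {n : ℕ} {A : Type*} [Fintype A] {U : Set (Fin n → ℝ)} {q : Fin n → (Fin n → ℝ) → ℝ}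
  {Γ : Fin n → Fin n → Fin n → (Fin n → ℝ) → ℝ} {W : A → Fin n → (Fin n → ℝ) → ℝ}
  {σ : A → A} {R V ξ η ζ : ℝ → Fin n → ℝ}

section Smoothness

variable (H : HydroStructure U q Γ W σ) (hR : ContDiff ℝ ∞ R) (hRU : ∀ x, R x ∈ U)
include H hR hRU

theorem contDiff_conn (hV : ContDiff ℝ ∞ V) (j i : Fin n) :
    ContDiff ℝ ∞ fun x => conn Γ (R x) (V x) j i :=
  ContDiff.sum fun k _ => (contDiff_apply_curve hV k).mul
    (contDiff_comp_curve (H.contDiffOn_conn j k i) hR hRU)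

theorem contDiff_dconn (hV : ContDiff ℝ ∞ V) {V' : ℝ → Fin n → ℝ} (hV' : ContDiff ℝ ∞ V')
    (j i : Fin n) : ContDiff ℝ ∞ fun x => dconn Γ (R x) (V x) (V' x) j i :=
  ContDiff.sum fun k _ => (contDiff_apply_curve hV' k).mul
    (contDiff_fderiv_curve H.isOpen (H.contDiffOn_conn j k i) hR hRU hV)

theorem contDiff_covD (hξ : ContDiff ℝ ∞ ξ) (i : Fin n) :
    ContDiff ℝ ∞ fun x => covD Γ R ξ x i :=
  (contDiff_apply_curve (contDiff_vel hξ) i).sub <| ContDiff.sum fun j _ =>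
    (H.contDiff_conn hR hRU (contDiff_vel hR) j i).mul (contDiff_apply_curve hξ j)

theorem contDiff_pairing (hV : ContDiff ℝ ∞ V) (hξ : ContDiff ℝ ∞ ξ) (α : A) :
    ContDiff ℝ ∞ (pairing W R V α ξ) :=
  ContDiff.sum fun j _ => ((contDiff_comp_curve (H.contDiffOn_affinor α j) hR hRU).mul
    (contDiff_apply_curve hV j)).mul (contDiff_apply_curve hξ j)

theorem contDiff_varPairing (hV : ContDiff ℝ ∞ V) (hξ : ContDiff ℝ ∞ ξ) (α : A) :
    ContDiff ℝ ∞ (varPairing W R V α ξ) :=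
  ContDiff.sum fun j _ => (((contDiff_fderiv_curve H.isOpen (H.contDiffOn_affinor α j) hR hRU
    hV).mul (contDiff_apply_curve (contDiff_vel hR) j)).add
      ((contDiff_comp_curve (H.contDiffOn_affinor α j) hR hRU).mul
        (contDiff_apply_curve (contDiff_vel hV) j))).mul (contDiff_apply_curve hξ j)

theorem contDiff_localDensity (hξ : ContDiff ℝ ∞ ξ) (hη : ContDiff ℝ ∞ η) :
    ContDiff ℝ ∞ (localDensity q Γ R ξ η) :=
  ContDiff.sum fun i _ => (contDiff_apply_curve hξ i).mul
    ((contDiff_comp_curve (H.contDiffOn_metric i) hR hRU).mul (H.contDiff_covD hR hRU hη i))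

theorem contDiff_varLocalDensity (hV : ContDiff ℝ ∞ V) (hξ : ContDiff ℝ ∞ ξ)
    (hη : ContDiff ℝ ∞ η) : ContDiff ℝ ∞ (varLocalDensity q Γ R V ξ η) := by
  refine ContDiff.sum fun i _ => (contDiff_apply_curve hξ i).mul
    (((contDiff_fderiv_curve H.isOpen (H.contDiffOn_metric i) hR hRU hV).mul
      (H.contDiff_covD hR hRU hη i)).sub
        ((contDiff_comp_curve (H.contDiffOn_metric i) hR hRU).mul (ContDiff.sum fun j _ => ?_)))
  exact ((H.contDiff_dconn hR hRU hV (contDiff_vel hR) j i).add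
    (H.contDiff_conn hR hRU (contDiff_vel hV) j i)).mul (contDiff_apply_curve hη j)

theorem contDiff_invD_pairing (hξ : IsTest ξ) (α : A) :
    ContDiff ℝ ∞ (invD (pairing W R (vel R) α ξ)) :=
  contDiff_invD (H.contDiff_pairing hR hRU (contDiff_vel hR) hξ.1 α)
    (hasCompactSupport_of_eq_zero hξ.2 fun _ => pairing_eq_zero)

theorem hasDerivAt_invD_pairing (hξ : IsTest ξ) (α : A) (x : ℝ) :
    HasDerivAt (invD (pairing W R (vel R) α ξ)) (pairing W R (vel R) α ξ x) x :=
  hasDerivAt_invD (H.contDiff_pairing hR hRU (contDiff_vel hR) hξ.1 α).continuous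
    (hasCompactSupport_of_eq_zero hξ.2 fun _ => pairing_eq_zero) x

theorem contDiff_tail (hξ : IsTest ξ) (i : Fin n) :
    ContDiff ℝ ∞ fun x => tail W σ R ξ x i :=
  ContDiff.sum fun α _ => (contDiff_comp_curve (H.contDiffOn_affinor α i) hR hRU).mul
    (H.contDiff_invD_pairing hR hRU hξ (σ α))

theorem contDiff_hydroOp (hξ : IsTest ξ) : ContDiff ℝ ∞ (hydroOp q Γ W σ R ξ) :=
  contDiff_pi.2 fun i => ((contDiff_comp_curve (H.contDiffOn_metric i) hR hRU).mul
    (H.contDiff_covD hR hRU hξ.1 i)).add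
      ((contDiff_apply_curve (contDiff_vel hR) i).mul (H.contDiff_tail hR hRU hξ i))

theorem contDiff_covVar (hV : ContDiff ℝ ∞ V) (hξ : ContDiff ℝ ∞ ξ) :
    ContDiff ℝ ∞ (covVar Γ R V ξ) :=
  contDiff_pi.2 fun i => ContDiff.neg <| ContDiff.sum fun j _ =>
    (H.contDiff_conn hR hRU hV j i).mul (contDiff_apply_curve hξ j)

end Smoothness

section Pointwise

variable (H : HydroStructure U q Γ W σ) (hR : ContDiff ℝ ∞ R) (hRU : ∀ x, R x ∈ U)
include H hR hRU

theorem hasDerivAt_conn (hV : ContDiff ℝ ∞ V) (j i : Fin n) (x : ℝ) :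
    HasDerivAt (fun y => conn Γ (R y) (V y) j i)
      (conn Γ (R x) (vel V x) j i + dconn Γ (R x) (vel R x) (V x) j i) x := by
  unfold conn dconn
  rw [← Finset.sum_add_distrib]
  exact HasDerivAt.fun_sum fun k _ => (hasDerivAt_apply hV x k).mul
    (hasDerivAt_comp_curve H.isOpen (H.contDiffOn_conn j k i) hR hRU x)

theorem vel_covVar (hV : ContDiff ℝ ∞ V) (hη : ContDiff ℝ ∞ η) (x : ℝ) (i : Fin n) :
    vel (covVar Γ R V η) x i = - ∑ j, ((conn Γ (R x) (vel V x) j i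
      + dconn Γ (R x) (vel R x) (V x) j i) * η x j + conn Γ (R x) (V x) j i * vel η x j) :=
  (HasDerivAt.fun_sum fun j _ =>
    (H.hasDerivAt_conn hR hRU hV j i x).fun_mul (hasDerivAt_apply hη x j)).fun_neg.deriv

/-- The derivative of the pairing of `W_α V` with a covector field. -/
theorem hasDerivAt_pairing (hV : ContDiff ℝ ∞ V) (hξ : ContDiff ℝ ∞ ξ) (α : A) (x : ℝ) :
    HasDerivAt (pairing W R V α ξ) (varPairing W R V α ξ x
      - pairing W R (vel R) α (covVar Γ R V ξ) x
      + ∑ i, covD Γ R ξ x i * (W α i (R x) * V x i)) x := by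
  have h : HasDerivAt (pairing W R V α ξ)
      (∑ j, ((fderiv ℝ (W α j) (R x) (vel R x) * V x j + W α j (R x) * vel V x j) * ξ x j
        + W α j (R x) * V x j * vel ξ x j)) x :=
    HasDerivAt.fun_sum fun j _ =>
      ((hasDerivAt_comp_curve H.isOpen (H.contDiffOn_affinor α j) hR hRU x).fun_mul
        (hasDerivAt_apply hV x j)).fun_mul (hasDerivAt_apply hξ x j)
  refine h.congr_deriv ?_
  -- The Codazzi equations exchange the roles of `R_x` and `V`: the `x`-derivative of `W_α V`
  -- becomes the variation of `W_α R_x`, up to connection terms.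
  have hc := fun j => H.conn_codazzi (hRU x) (vel R x) (V x) α j
  have e1 : pairing W R (vel R) α (covVar Γ R V ξ) x
      = - ∑ j, ξ x j * ∑ i, conn Γ (R x) (V x) j i * (W α i (R x) * vel R x i) := by
    simp only [pairing, covVar, Finset.mul_sum, mul_neg, Finset.sum_neg_distrib]
    rw [Finset.sum_comm]
    congr 1
    exact Finset.sum_congr rfl fun j _ => Finset.sum_congr rfl fun i _ => by ring
  have e2 : ∑ i, covD Γ R ξ x i * (W α i (R x) * V x i)
      = ∑ i, vel ξ x i * (W α i (R x) * V x i)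
        - ∑ j, ξ x j * ∑ i, conn Γ (R x) (vel R x) j i * (W α i (R x) * V x i) := by
    simp only [covD, sub_mul, Finset.sum_sub_distrib, Finset.mul_sum, Finset.sum_mul]
    congr 1
    rw [Finset.sum_comm]
    exact Finset.sum_congr rfl fun j _ => Finset.sum_congr rfl fun i _ => by ring
  rw [e1, e2, varPairing, sub_neg_eq_add, ← Finset.sum_add_distrib, ← Finset.sum_sub_distrib,
    ← Finset.sum_add_distrib]
  refine Finset.sum_congr rfl fun j _ => ?_
  linear_combination (ξ x j) * hc j

/-- Since the connection preserves the metric, `D` obeys the Leibniz rule for the inner product. The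
local part of the bracket is therefore skew up to a total derivative. -/
theorem hasDerivAt_sum_metric (hξ : ContDiff ℝ ∞ ξ) (hη : ContDiff ℝ ∞ η) (x : ℝ) :
    HasDerivAt (fun y => ∑ i, ξ y i * (q i (R y) * η y i))
      (localDensity q Γ R ξ η x + localDensity q Γ R η ξ x) x := by
  have h : HasDerivAt (fun y => ∑ i, ξ y i * (q i (R y) * η y i))
      (∑ i, (vel ξ x i * (q i (R x) * η x i)
        + ξ x i * (fderiv ℝ (q i) (R x) (vel R x) * η x i + q i (R x) * vel η x i))) x :=
    HasDerivAt.fun_sum fun i _ => (hasDerivAt_apply hξ x i).fun_mul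
      ((hasDerivAt_comp_curve H.isOpen (H.contDiffOn_metric i) hR hRU x).fun_mul
        (hasDerivAt_apply hη x i))
  refine h.congr_deriv ?_
  have e : ∑ i, ∑ j, ξ x i * η x j * ((if i = j then fderiv ℝ (q i) (R x) (vel R x) else 0)
      + conn Γ (R x) (vel R x) i j * q j (R x) + conn Γ (R x) (vel R x) j i * q i (R x)) = 0 :=
    Finset.sum_eq_zero fun i _ => Finset.sum_eq_zero fun j _ => by
      rw [H.conn_metric (hRU x), mul_zero]
  simp only [mul_add, Finset.sum_add_distrib, mul_ite, mul_zero, Finset.sum_ite_eq,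
    Finset.mem_univ, if_true] at e
  simp only [localDensity, covD, mul_sub, Finset.sum_sub_distrib, mul_add,
    Finset.sum_add_distrib, Finset.mul_sum]
  have e1 : ∑ i, ∑ j, ξ x i * η x j * (conn Γ (R x) (vel R x) i j * q j (R x))
      = ∑ i, ∑ j, η x i * (q i (R x) * (conn Γ (R x) (vel R x) j i * ξ x j)) := by
    rw [Finset.sum_comm]
    exact Finset.sum_congr rfl fun j _ => Finset.sum_congr rfl fun i _ => by ring
  have e2 : ∑ i, ∑ j, ξ x i * η x j * (conn Γ (R x) (vel R x) j i * q i (R x))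
      = ∑ i, ∑ j, ξ x i * (q i (R x) * (conn Γ (R x) (vel R x) j i * η x j)) :=
    Finset.sum_congr rfl fun j _ => Finset.sum_congr rfl fun i _ => by ring
  have e3 : ∑ i, ξ x i * η x i * fderiv ℝ (q i) (R x) (vel R x)
      = ∑ i, ξ x i * (fderiv ℝ (q i) (R x) (vel R x) * η x i) :=
    Finset.sum_congr rfl fun i _ => by ring
  have e4 : ∑ i, vel ξ x i * (q i (R x) * η x i) = ∑ i, η x i * (q i (R x) * vel ξ x i) :=
    Finset.sum_congr rfl fun i _ => by ring
  linarith

/-- Commutation of `D` with the covariant variation. The first two sums are the covariant variation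
of `Dη`, the components of `η` being held fixed; the last is the curvature in the directions `R_x`
and `V` applied to `η`. -/
theorem covD_covVar (hV : ContDiff ℝ ∞ V) (hη : ContDiff ℝ ∞ η) (x : ℝ) (i : Fin n) :
    covD Γ R (covVar Γ R V η) x i
      = - (∑ j, (dconn Γ (R x) (V x) (vel R x) j i + conn Γ (R x) (vel V x) j i) * η x j)
        - (∑ j, conn Γ (R x) (V x) j i * covD Γ R η x j)
        - ∑ m, η x m * (dconn Γ (R x) (vel R x) (V x) m i - dconn Γ (R x) (V x) (vel R x) m i
          + ∑ j, (conn Γ (R x) (vel R x) m j * conn Γ (R x) (V x) j i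
            - conn Γ (R x) (V x) m j * conn Γ (R x) (vel R x) j i)) := by
  rw [covD, H.vel_covVar hR hRU hV hη]
  have e1 : ∑ j, conn Γ (R x) (vel R x) j i * covVar Γ R V η x j
      = - ∑ m, η x m * ∑ j, conn Γ (R x) (V x) m j * conn Γ (R x) (vel R x) j i := by
    simp only [covVar, mul_neg, Finset.sum_neg_distrib, Finset.mul_sum]
    rw [Finset.sum_comm]
    congr 1
    exact Finset.sum_congr rfl fun m _ => Finset.sum_congr rfl fun j _ => by ring
  have e2 : ∑ j, conn Γ (R x) (V x) j i * covD Γ R η x j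
      = ∑ j, conn Γ (R x) (V x) j i * vel η x j
        - ∑ m, η x m * ∑ j, conn Γ (R x) (vel R x) m j * conn Γ (R x) (V x) j i := by
    simp only [covD, mul_sub, Finset.sum_sub_distrib, Finset.mul_sum]
    congr 1
    rw [Finset.sum_comm]
    exact Finset.sum_congr rfl fun m _ => Finset.sum_congr rfl fun j _ => by ring
  rw [e1, e2]
  simp only [← Finset.sum_neg_distrib, ← Finset.sum_sub_distrib]
  exact Finset.sum_congr rfl fun m _ => by rw [Finset.sum_sub_distrib]; ring

/-- The variation of the local density: the curvature of the connection is compensated by the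
affinors. -/
theorem localDensity_covVar (hV : ContDiff ℝ ∞ V) (hη : ContDiff ℝ ∞ η) (x : ℝ) :
    localDensity q Γ R ξ (covVar Γ R V η) x = varLocalDensity q Γ R V ξ η x
      - localDensity q Γ R (covVar Γ R V ξ) η x
      - ∑ α, (pairing W R V α ξ x * pairing W R (vel R) (σ α) η x
        - pairing W R V α η x * pairing W R (vel R) (σ α) ξ x) := by
  -- Metric compatibility in the direction `V` moves the connection from `ξ` to `Dη`.
  have e1 : localDensity q Γ R (covVar Γ R V ξ) η x
      = ∑ i, ξ x i * (fderiv ℝ (q i) (R x) (V x) * covD Γ R η x i)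
        + ∑ i, ξ x i * (q i (R x) * ∑ j, conn Γ (R x) (V x) j i * covD Γ R η x j) := by
    have h : ∑ i, ∑ j, ξ x i * covD Γ R η x j *
        ((if i = j then fderiv ℝ (q i) (R x) (V x) else 0)
        + conn Γ (R x) (V x) i j * q j (R x) + conn Γ (R x) (V x) j i * q i (R x)) = 0 :=
      Finset.sum_eq_zero fun i _ => Finset.sum_eq_zero fun j _ => by
        rw [H.conn_metric (hRU x), mul_zero]
    simp only [mul_add, Finset.sum_add_distrib, mul_ite, mul_zero, Finset.sum_ite_eq,
      Finset.mem_univ, if_true] at h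
    have a1 : localDensity q Γ R (covVar Γ R V ξ) η x
        = - ∑ i, ∑ j, ξ x i * covD Γ R η x j * (conn Γ (R x) (V x) i j * q j (R x)) := by
      simp only [localDensity, covVar, neg_mul, Finset.sum_neg_distrib, Finset.sum_mul]
      rw [Finset.sum_comm]
      congr 1
      exact Finset.sum_congr rfl fun m _ => Finset.sum_congr rfl fun j _ => by ring
    have a2 : ∑ i, ∑ j, ξ x i * covD Γ R η x j * (conn Γ (R x) (V x) j i * q i (R x))
        = ∑ i, ξ x i * (q i (R x) * ∑ j, conn Γ (R x) (V x) j i * covD Γ R η x j) := by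
      simp only [Finset.mul_sum]
      exact Finset.sum_congr rfl fun m _ => Finset.sum_congr rfl fun j _ => by ring
    have a3 : ∑ i, ξ x i * covD Γ R η x i * fderiv ℝ (q i) (R x) (V x)
        = ∑ i, ξ x i * (fderiv ℝ (q i) (R x) (V x) * covD Γ R η x i) :=
      Finset.sum_congr rfl fun m _ => by ring
    linarith
  have e2 : ∑ α, (pairing W R V α ξ x * pairing W R (vel R) (σ α) η x
        - pairing W R V α η x * pairing W R (vel R) (σ α) ξ x)
      = ∑ i, ξ x i * ∑ m, η x m * ∑ α, W α m (R x) * W (σ α) i (R x)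
        * (vel R x m * V x i - V x m * vel R x i) := by
    -- Relabelling by the involution brings both products to the index pattern of the Gauss
    -- equation.
    have s1 : ∑ α, pairing W R V α ξ x * pairing W R (vel R) (σ α) η x
        = ∑ α, pairing W R V (σ α) ξ x * pairing W R (vel R) α η x := by
      rw [← Equiv.sum_comp H.involutive.toPerm]
      refine Finset.sum_congr rfl fun α _ => ?_
      simp only [Function.Involutive.coe_toPerm, H.involutive α]
    rw [Finset.sum_sub_distrib, s1, ← Finset.sum_sub_distrib]
    have s2 : ∀ α, pairing W R V (σ α) ξ x * pairing W R (vel R) α η x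
          - pairing W R V α η x * pairing W R (vel R) (σ α) ξ x
        = ∑ i, ∑ m, ξ x i * (η x m * (W α m (R x) * W (σ α) i (R x)
          * (vel R x m * V x i - V x m * vel R x i))) := by
      intro α
      rw [mul_comm (pairing W R V α η x)]
      simp only [pairing, Finset.sum_mul_sum, ← Finset.sum_sub_distrib]
      exact Finset.sum_congr rfl fun i _ => Finset.sum_congr rfl fun m _ => by ring
    simp only [s2, Finset.mul_sum]
    rw [Finset.sum_comm]
    exact Finset.sum_congr rfl fun i _ => Finset.sum_comm
  have e3 : ∀ i, q i (R x) * ∑ m, η x m * (dconn Γ (R x) (vel R x) (V x) m i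
        - dconn Γ (R x) (V x) (vel R x) m i
          + ∑ j, (conn Γ (R x) (vel R x) m j * conn Γ (R x) (V x) j i
            - conn Γ (R x) (V x) m j * conn Γ (R x) (vel R x) j i))
      = ∑ m, η x m * ∑ α, W α m (R x) * W (σ α) i (R x)
        * (vel R x m * V x i - V x m * vel R x i) := by
    intro i
    rw [Finset.mul_sum]
    refine Finset.sum_congr rfl fun m _ => ?_
    rw [mul_left_comm, H.conn_gauss (hRU x)]
  rw [e1, e2, localDensity, varLocalDensity, ← Finset.sum_add_distrib,
    ← Finset.sum_sub_distrib, ← Finset.sum_sub_distrib]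
  refine Finset.sum_congr rfl fun i _ => ?_
  rw [← e3, H.covD_covVar hR hRU hV hη]
  ring

end Pointwise

end HydroStructure

theorem IsC1Family.congr_deriv {δ a b : ℝ} {f f' k' : ℝ → ℝ → ℝ} (h : IsC1Family δ a b f f')
    (hk : ∀ ε x, f' ε x = k' ε x) : IsC1Family δ a b f k' := by
  rwa [show k' = f' from funext fun ε => funext fun x => (hk ε x).symm]

theorem integrable_mul_invD {φ ψ : ℝ → ℝ} (hφ : ContDiff ℝ ∞ φ) (hφs : HasCompactSupport φ)
    (hψ : ContDiff ℝ ∞ ψ) (hψs : HasCompactSupport ψ) :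
    Integrable fun x => φ x * invD ψ x :=
  (hφ.continuous.mul (contDiff_invD hψ hψs).continuous).integrable_of_hasCompactSupport
    hφs.mul_right

/-! ### First variation along a perturbed field. -/

section PerturbedField

variable {n : ℕ} {U : Set (Fin n → ℝ)} {R V : ℝ → Fin n → ℝ} {δ a b : ℝ}

/-- Because of the nonlocal tails, a Hamiltonian vector field need not have compact support, so no
single range of `ε` need keep the perturbed field in `U` everywhere. The tube lemma gives one over a
compact interval, which suffices because the test covectors vanish outside it. -/
theorem exists_perturbation_mem (hU : IsOpen U) (hR : Continuous R) (hV : Continuous V)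
    (hRU : ∀ x, R x ∈ U) (a b : ℝ) :
    ∃ δ : ℝ, 0 < δ ∧ ∀ ε ∈ Icc (-δ) δ, ∀ x ∈ Icc a b, R x + ε • V x ∈ U := by
  have hO : IsOpen {p : ℝ × ℝ | R p.2 + p.1 • V p.2 ∈ U} :=
    hU.preimage (by fun_prop)
  obtain ⟨u, v, hu, -, h0, hv, huv⟩ := generalized_tube_lemma (isCompact_singleton (x := (0 : ℝ)))
    (isCompact_Icc (a := a) (b := b)) hO (by
      rintro ⟨e, x⟩ ⟨he, -⟩
      rw [mem_singleton_iff] at he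
      simp only at he
      simp [he, hRU x])
  obtain ⟨δ, hδ, hs⟩ := Metric.nhds_basis_closedBall.mem_iff.1
    (hu.mem_nhds (h0 (mem_singleton (0 : ℝ))))
  rw [Real.closedBall_eq_Icc, zero_sub, zero_add] at hs
  exact ⟨δ, hδ, fun ε hε x hx => huv (mk_mem_prod (hs hε) (hv hx))⟩

theorem vel_perturbation (hR : ContDiff ℝ ∞ R) (hV : ContDiff ℝ ∞ V) (ε x : ℝ) (i : Fin n) :
    vel (fun y => R y + ε • V y) x i = vel R x i + ε * vel V x i :=
  ((hasDerivAt_apply hR x i).add ((hasDerivAt_apply hV x i).const_mul ε)).deriv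

theorem isC1Family_comp (hU : IsOpen U) (hR : ContDiff ℝ ∞ R) (hV : ContDiff ℝ ∞ V)
    (hmem : ∀ ε ∈ Icc (-δ) δ, ∀ x ∈ Icc a b, R x + ε • V x ∈ U) {f : (Fin n → ℝ) → ℝ}
    (hf : ContDiffOn ℝ ∞ f U) :
    IsC1Family δ a b (fun ε x => f (R x + ε • V x))
      (fun ε x => fderiv ℝ f (R x + ε • V x) (V x)) := by
  have cR := hR.continuous
  have cV := hV.continuous
  have hc : Continuous fun p : ℝ × ℝ => R p.2 + p.1 • V p.2 := by fun_prop
  have hm : MapsTo (fun p : ℝ × ℝ => R p.2 + p.1 • V p.2) (Icc (-δ) δ ×ˢ Icc a b) U :=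
    fun p hp => hmem p.1 hp.1 p.2 hp.2
  refine ⟨hf.continuousOn.comp hc.continuousOn hm, ?_, fun ε hε x hx => ?_⟩
  · exact ((hf.fderiv_of_isOpen hU (m := ∞) (by simp)).continuousOn.comp hc.continuousOn
      hm).clm_apply (cV.comp continuous_snd).continuousOn
  · have h1 := (differentiableAt_of_mem hU hf
      (hmem ε (Ioo_subset_Icc_self hε) x hx)).hasFDerivAt
    have h2 : HasDerivAt (fun e : ℝ => R x + e • V x) (V x) ε := by
      simpa using ((hasDerivAt_id ε).smul_const (V x)).const_add (R x)
    exact h1.comp_hasDerivAt ε h2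

theorem isC1Family_vel (hR : ContDiff ℝ ∞ R) (hV : ContDiff ℝ ∞ V) (i : Fin n) :
    IsC1Family δ a b (fun ε x => vel (fun y => R y + ε • V y) x i) (fun _ x => vel V x i) := by
  have cR : Continuous fun x => vel R x i := (contDiff_pi.1 (contDiff_vel hR) i).continuous
  have cV : Continuous fun x => vel V x i := (contDiff_pi.1 (contDiff_vel hV) i).continuous
  simp only [vel_perturbation hR hV]
  refine ⟨?_, ?_, fun ε _ x _ => ?_⟩
  · exact ((cR.comp continuous_snd).add
      (continuous_fst.mul (cV.comp continuous_snd))).continuousOn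
  · exact (cV.comp continuous_snd).continuousOn
  · simpa using ((hasDerivAt_id ε).mul_const (vel V x i)).const_add (vel R x i)

end PerturbedField

namespace HydroStructure

variable {n : ℕ} {A : Type*} [Fintype A] {U : Set (Fin n → ℝ)} {q : Fin n → (Fin n → ℝ) → ℝ}
  {Γ : Fin n → Fin n → Fin n → (Fin n → ℝ) → ℝ} {W : A → Fin n → (Fin n → ℝ) → ℝ}
  {σ : A → A} {R V ξ η ζ : ℝ → Fin n → ℝ} {δ a b : ℝ}

section FirstVariation

variable (H : HydroStructure U q Γ W σ) (hR : ContDiff ℝ ∞ R) (hV : ContDiff ℝ ∞ V)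
  (hmem : ∀ ε ∈ Icc (-δ) δ, ∀ x ∈ Icc a b, R x + ε • V x ∈ U)
include H hR hV hmem

theorem isC1Family_pairing (hξ : ContDiff ℝ ∞ ξ) (α : A) :
    IsC1Family δ a b
      (fun ε x => pairing W (fun y => R y + ε • V y) (vel fun y => R y + ε • V y) α ξ x)
      (fun ε x => varPairing W (fun y => R y + ε • V y) V α ξ x) := by
  unfold pairing
  refine (IsC1Family.sum Finset.univ fun j =>
    ((isC1Family_comp H.isOpen hR hV hmem (H.contDiffOn_affinor α j)).mul
      (isC1Family_vel hR hV j)).mul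
        (IsC1Family.const (contDiff_apply_curve hξ j).continuous.continuousOn)).congr_deriv
          fun ε x => ?_
  exact Finset.sum_congr rfl fun j _ => by ring

theorem isC1Family_localDensity (hξ : ContDiff ℝ ∞ ξ) (hη : ContDiff ℝ ∞ η) :
    IsC1Family δ a b (fun ε x => localDensity q Γ (fun y => R y + ε • V y) ξ η x)
      (fun ε x => varLocalDensity q Γ (fun y => R y + ε • V y) V ξ η x) := by
  have hconn : ∀ j i, IsC1Family δ a b
      (fun ε x => conn Γ (R x + ε • V x) (vel (fun y => R y + ε • V y) x) j i)
      (fun ε x => dconn Γ (R x + ε • V x) (V x) (vel (fun y => R y + ε • V y) x) j i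
        + conn Γ (R x + ε • V x) (vel V x) j i) := by
    intro j i
    refine (IsC1Family.sum Finset.univ fun k => (isC1Family_vel hR hV k).mul
      (isC1Family_comp H.isOpen hR hV hmem (H.contDiffOn_conn j k i))).congr_deriv fun ε x => ?_
    rw [Finset.sum_add_distrib, add_comm]
    rfl
  have hcov : ∀ i, IsC1Family δ a b (fun ε x => covD Γ (fun y => R y + ε • V y) η x i)
      (fun ε x => - ∑ j, (dconn Γ (R x + ε • V x) (V x) (vel (fun y => R y + ε • V y) x) j i
        + conn Γ (R x + ε • V x) (vel V x) j i) * η x j) := by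
    intro i
    refine ((IsC1Family.const (contDiff_apply_curve (contDiff_vel hη)
      i).continuous.continuousOn).sub (IsC1Family.sum Finset.univ fun j => (hconn j i).mul
        (IsC1Family.const (contDiff_apply_curve hη j).continuous.continuousOn))).congr_deriv
          fun ε x => ?_
    simp only [mul_zero, add_zero, zero_sub]
  unfold localDensity
  refine (IsC1Family.sum Finset.univ fun i =>
    (IsC1Family.const (contDiff_apply_curve hξ i).continuous.continuousOn).mul
      ((isC1Family_comp H.isOpen hR hV hmem (H.contDiffOn_metric i)).mul (hcov i))).congr_deriv
        fun ε x => ?_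
  exact Finset.sum_congr rfl fun j _ => by ring

end FirstVariation

/-! ### Skew-symmetry and the Jacobi identity. -/

section Bracket

variable (H : HydroStructure U q Γ W σ) (hR : ContDiff ℝ ∞ R) (hRU : ∀ x, R x ∈ U)
include H hR hRU

/-- Near `ε = 0` the bracket is an integral over one fixed interval containing the supports of both
test covectors; there the density, nonlocal factors included, is a `C¹` family, so the formal
variation is legitimate. -/
theorem hasDerivAt_bracket (hV : ContDiff ℝ ∞ V) (hξ : IsTest ξ) (hη : IsTest η) :
    HasDerivAt (fun ε : ℝ => bracket (hydroOp q Γ W σ) ξ η fun x => R x + ε • V x)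
      (∫ x, (varLocalDensity q Γ R V ξ η x
        + ∑ α, (varPairing W R V α ξ x * invD (pairing W R (vel R) (σ α) η) x
          + pairing W R (vel R) α ξ x * invD (varPairing W R V (σ α) η) x))) 0 := by
  obtain ⟨r, hr, hξr⟩ := exists_Ioo_of_hasCompactSupport hξ.2
  obtain ⟨s, hs, hηs⟩ := exists_Ioo_of_hasCompactSupport hη.2
  set t := max r s
  have ht : 0 < t := lt_max_of_lt_left hr
  have hab : -t ≤ t := by linarith
  have hξt : ∀ x, x ∉ Ioo (-t) t → ξ x = 0 := fun x hx => hξr x fun hx' =>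
    hx ⟨by linarith [le_max_left r s, hx'.1], by linarith [le_max_left r s, hx'.2]⟩
  have hηt : ∀ x, x ∉ Ioo (-t) t → η x = 0 := fun x hx => hηs x fun hx' =>
    hx ⟨by linarith [le_max_right r s, hx'.1], by linarith [le_max_right r s, hx'.2]⟩
  obtain ⟨δ, hδ, hmem⟩ := exists_perturbation_mem H.isOpen hR.continuous hV.continuous hRU (-t) t
  have h0 : (0 : ℝ) ∈ Ioo (-δ) δ := ⟨by linarith, hδ⟩
  have fp := fun α => H.isC1Family_pairing hR hV hmem hξ.1 α
  have fq := fun α => H.isC1Family_pairing hR hV hmem hη.1 α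
  have fam := (H.isC1Family_localDensity hR hV hmem hξ.1 hη.1).add
    (IsC1Family.sum Finset.univ fun α => (fp α).mul ((fq (σ α)).skewIntegral hδ.le hab))
  have hd := fam.hasDerivAt_integral h0 (right_mem_Icc.2 hab)
  simp only [zero_smul, add_zero] at hd
  have hinv : ∀ ε ∈ Icc (-δ) δ, ∀ α x,
      invD (pairing W (fun y => R y + ε • V y) (vel fun y => R y + ε • V y) α η) x
      = (∫ y in (-t)..x, pairing W (fun y => R y + ε • V y) (vel fun y => R y + ε • V y) α η y)
        - (1 / 2 : ℝ) * ∫ y in (-t)..t,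
          pairing W (fun y => R y + ε • V y) (vel fun y => R y + ε • V y) α η y :=
    fun ε hε α x => invD_eq_intervalIntegral ((fq α).continuousOn_slice hε)
      (fun x hx => pairing_eq_zero (hηt x hx)) x
  have hinv' : ∀ α x, invD (varPairing W R V α η) x
      = (∫ y in (-t)..x, varPairing W R V α η y)
        - (1 / 2 : ℝ) * ∫ y in (-t)..t, varPairing W R V α η y :=
    fun α x => invD_eq_intervalIntegral
      (H.contDiff_varPairing hR hRU hV hη.1 α).continuous.continuousOn
      (fun x hx => varPairing_eq_zero (hηt x hx)) x
  have hinv0 := hinv 0 (Ioo_subset_Icc_self h0)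
  simp only [zero_smul, add_zero] at hinv0
  refine (hd.congr_of_eventuallyEq ?_).congr_deriv ?_
  · filter_upwards [Ioo_mem_nhds h0.1 h0.2] with ε hε
    simp only [bracket, sum_mul_hydroOp, hinv ε (Ioo_subset_Icc_self hε)]
    exact integral_eq_intervalIntegral fun x hx => by
      simp [localDensity_eq_zero (hξt x hx), pairing_eq_zero (hξt x hx)]
  · simp only [hinv', hinv0]
    exact (integral_eq_intervalIntegral fun x hx => by
      simp [varLocalDensity_eq_zero (hξt x hx), pairing_eq_zero (hξt x hx),
        varPairing_eq_zero (hξt x hx)]).symm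

theorem integrable_bracket (hξ : IsTest ξ) (hη : IsTest η) :
    Integrable fun x => ∑ i, ξ x i * hydroOp q Γ W σ R η x i := by
  have h := contDiff_pi.1 (H.contDiff_hydroOp hR hRU hη)
  refine Continuous.integrable_of_hasCompactSupport ?_
    (hasCompactSupport_of_eq_zero hξ.2 fun x hx => by simp [hx])
  exact continuous_finsetSum _ fun i _ => (isTest_apply hξ i).continuous.mul (h i).continuous

/-- The pairing of `W_α V` with a covector field, integrated by parts against the nonlocal
factors. -/
theorem hasDerivAt_pairing_mul_invD (hV : ContDiff ℝ ∞ V) (hξ : IsTest ξ) (hη : IsTest η) (α : A)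
    (x : ℝ) :
    HasDerivAt (fun y => pairing W R V α ξ y * invD (pairing W R (vel R) (σ α) η) y)
      ((varPairing W R V α ξ x - pairing W R (vel R) α (covVar Γ R V ξ) x
        + ∑ i, covD Γ R ξ x i * (W α i (R x) * V x i))
          * invD (pairing W R (vel R) (σ α) η) x
        + pairing W R V α ξ x * pairing W R (vel R) (σ α) η x) x :=
  (H.hasDerivAt_pairing hR hRU hV hξ.1 α x).fun_mul
    (H.hasDerivAt_invD_pairing hR hRU hη (σ α) x)

/-- Skew-symmetry of `invD` followed by relabelling with `σ` turns the first sum into minus the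
second. This removes the antiderivatives of varied pairings from the variation of the bracket. -/
theorem sum_integral_pairing_mul_invD (hV : ContDiff ℝ ∞ V) (hξ : IsTest ξ) (hη : IsTest η) :
    ∫ x, ∑ α, (pairing W R (vel R) α ξ x * invD (varPairing W R V (σ α) η) x
      + varPairing W R V α η x * invD (pairing W R (vel R) (σ α) ξ) x) = 0 := by
  have c1 := fun α => H.contDiff_pairing hR hRU (contDiff_vel hR) hξ.1 α
  have c2 := fun α => H.contDiff_varPairing hR hRU hV hη.1 α
  have s1 : ∀ α, HasCompactSupport (pairing W R (vel R) α ξ) := fun α =>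
    hasCompactSupport_of_eq_zero hξ.2 fun _ => pairing_eq_zero
  have s2 : ∀ α, HasCompactSupport (varPairing W R V α η) := fun α =>
    hasCompactSupport_of_eq_zero hη.2 fun _ => varPairing_eq_zero
  have i1 := fun α => integrable_mul_invD (c1 α) (s1 α) (c2 (σ α)) (s2 (σ α))
  have i2 := fun α => integrable_mul_invD (c2 α) (s2 α) (c1 (σ α)) (s1 (σ α))
  rw [integral_finsetSum _ fun α _ => (i1 α).fun_add (i2 α)]
  simp only [integral_add (i1 _) (i2 _)]
  rw [Finset.sum_add_distrib]
  have : ∑ α, ∫ x, pairing W R (vel R) α ξ x * invD (varPairing W R V (σ α) η) x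
      = - ∑ α, ∫ x, varPairing W R V α η x * invD (pairing W R (vel R) (σ α) ξ) x := by
    rw [← Equiv.sum_comp H.involutive.toPerm, ← Finset.sum_neg_distrib]
    refine Finset.sum_congr rfl fun α _ => ?_
    simp only [Function.Involutive.coe_toPerm, H.involutive α]
    exact integral_mul_invD (c1 _).continuous (s1 _) (c2 _).continuous (s2 _)
  rw [this, neg_add_cancel]

/-- The variation of the bracket, up to terms which are tensorial in the covector fields. -/
theorem integral_variation (hV : ContDiff ℝ ∞ V) (hξ : IsTest ξ) (hη : IsTest η) :
    Integrable (fun x => ∑ i, (covVar Γ R V ξ x i * hydroOp q Γ W σ R η x i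
        - covVar Γ R V η x i * hydroOp q Γ W σ R ξ x i
        + V x i * (covD Γ R η x i * tail W σ R ξ x i - covD Γ R ξ x i * tail W σ R η x i))) ∧
    ∫ x, (varLocalDensity q Γ R V ξ η x
        + ∑ α, (varPairing W R V α ξ x * invD (pairing W R (vel R) (σ α) η) x
          + pairing W R (vel R) α ξ x * invD (varPairing W R V (σ α) η) x))
      = ∫ x, ∑ i, (covVar Γ R V ξ x i * hydroOp q Γ W σ R η x i
        - covVar Γ R V η x i * hydroOp q Γ W σ R ξ x i
        + V x i * (covD Γ R η x i * tail W σ R ξ x i - covD Γ R ξ x i * tail W σ R η x i)) := by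
  set L : ℝ → ℝ := fun x => varLocalDensity q Γ R V ξ η x
        + ∑ α, (varPairing W R V α ξ x * invD (pairing W R (vel R) (σ α) η) x
          + pairing W R (vel R) α ξ x * invD (varPairing W R V (σ α) η) x) with hL
  set T : ℝ → ℝ := fun x => ∑ α, (pairing W R (vel R) α ξ x * invD (varPairing W R V (σ α) η) x
      + varPairing W R V α η x * invD (pairing W R (vel R) (σ α) ξ) x) with hT
  -- The boundary term of the integrations by parts, local and nonlocal. It has compact support, so
  -- its derivative integrates to zero.
  set B : ℝ → ℝ := fun x => ∑ i, ξ x i * (q i (R x) * covVar Γ R V η x i)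
    + ∑ α, (pairing W R V α ξ x * invD (pairing W R (vel R) (σ α) η) x
      - pairing W R V α η x * invD (pairing W R (vel R) (σ α) ξ) x) with hB
  have c1 := fun α => H.contDiff_pairing hR hRU (contDiff_vel hR) hξ.1 α
  have c2 := fun α => H.contDiff_varPairing hR hRU hV hη.1 α
  have c1' := fun α => H.contDiff_pairing hR hRU (contDiff_vel hR) hη.1 α
  have c2' := fun α => H.contDiff_varPairing hR hRU hV hξ.1 α
  have s1 : ∀ α, HasCompactSupport (pairing W R (vel R) α ξ) := fun α =>
    hasCompactSupport_of_eq_zero hξ.2 fun _ => pairing_eq_zero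
  have s2 : ∀ α, HasCompactSupport (varPairing W R V α η) := fun α =>
    hasCompactSupport_of_eq_zero hη.2 fun _ => varPairing_eq_zero
  have s1' : ∀ α, HasCompactSupport (pairing W R (vel R) α η) := fun α =>
    hasCompactSupport_of_eq_zero hη.2 fun _ => pairing_eq_zero
  have s2' : ∀ α, HasCompactSupport (varPairing W R V α ξ) := fun α =>
    hasCompactSupport_of_eq_zero hξ.2 fun _ => varPairing_eq_zero
  have iL : Integrable L :=
    ((H.contDiff_varLocalDensity hR hRU hV hξ.1 hη.1).continuous.integrable_of_hasCompactSupport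
      (hasCompactSupport_of_eq_zero hξ.2 fun _ => varLocalDensity_eq_zero)).add <|
    integrable_finsetSum _ fun α _ =>
      (integrable_mul_invD (c2' α) (s2' α) (c1' (σ α)) (s1' (σ α))).add
        (integrable_mul_invD (c1 α) (s1 α) (c2 (σ α)) (s2 (σ α)))
  have iT : Integrable T :=
    integrable_finsetSum _ fun α _ =>
      (integrable_mul_invD (c1 α) (s1 α) (c2 (σ α)) (s2 (σ α))).add
        (integrable_mul_invD (c2 α) (s2 α) (c1 (σ α)) (s1 (σ α)))
  have cB : ContDiff ℝ ∞ B := by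
    refine (ContDiff.sum fun i _ => (isTest_apply hξ i).mul
      ((contDiff_comp_curve (H.contDiffOn_metric i) hR hRU).mul (contDiff_pi.1
        (H.contDiff_covVar hR hRU hV hη.1) i))).add (ContDiff.sum fun α _ => ?_)
    exact ((H.contDiff_pairing hR hRU hV hξ.1 α).mul
      (H.contDiff_invD_pairing hR hRU hη (σ α))).sub
        ((H.contDiff_pairing hR hRU hV hη.1 α).mul (H.contDiff_invD_pairing hR hRU hξ (σ α)))
  have sB : HasCompactSupport B := by
    refine HasCompactSupport.add (hasCompactSupport_of_eq_zero hξ.2 fun x hx => by simp [hx]) ?_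
    simp only [Finset.sum_sub_distrib]
    exact HasCompactSupport.sub
      (hasCompactSupport_of_eq_zero hξ.2 fun x hx => by simp [pairing_eq_zero hx])
      (hasCompactSupport_of_eq_zero hη.2 fun x hx => by simp [pairing_eq_zero hx])
  have dB : ∀ x, HasDerivAt B (deriv B x) x := fun x =>
    (cB.differentiable (by simp) x).hasDerivAt
  have cB' : Continuous (deriv B) := (contDiff_infty_iff_deriv.1 cB).2.continuous
  have iB : Integrable (deriv B) := cB'.integrable_of_hasCompactSupport sB.deriv
  have zB : ∫ x, deriv B x = 0 := integral_deriv_eq_zero_of_hasCompactSupport dB cB' sB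
  have zT : ∫ x, T x = 0 := H.sum_integral_pairing_mul_invD hR hRU hV hξ hη
  -- In the derivative of `B`, the products of two pairings that come from differentiating the
  -- `invD` factors cancel those that the Gauss equation supplies in `localDensity_covVar`.
  have key : (fun x => ∑ i, (covVar Γ R V ξ x i * hydroOp q Γ W σ R η x i
        - covVar Γ R V η x i * hydroOp q Γ W σ R ξ x i
        + V x i * (covD Γ R η x i * tail W σ R ξ x i - covD Γ R ξ x i * tail W σ R η x i)))
      = fun x => L x - T x - deriv B x := by
    funext x
    have hd := (H.hasDerivAt_sum_metric hR hRU hξ.1 (H.contDiff_covVar hR hRU hV hη.1) x).fun_add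
      (HasDerivAt.fun_sum fun α (_ : α ∈ Finset.univ) =>
        (H.hasDerivAt_pairing_mul_invD hR hRU hV hξ hη α x).fun_sub
          (H.hasDerivAt_pairing_mul_invD hR hRU hV hη hξ α x))
    rw [hB, hd.deriv, H.localDensity_covVar hR hRU hV hη.1]
    have e : ∀ φ ψ : ℝ → Fin n → ℝ, ∑ i, V x i * (covD Γ R φ x i * tail W σ R ψ x i)
        = ∑ α, (∑ i, covD Γ R φ x i * (W α i (R x) * V x i))
          * invD (pairing W R (vel R) (σ α) ψ) x := by
      intro φ ψ
      simp only [tail, Finset.mul_sum, Finset.sum_mul]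
      rw [Finset.sum_comm]
      exact Finset.sum_congr rfl fun i _ => Finset.sum_congr rfl fun k _ => by ring
    simp only [mul_sub, Finset.sum_add_distrib, Finset.sum_sub_distrib, e, sum_mul_hydroOp,
      hL, hT, add_mul, sub_mul]
    ring
  refine ⟨key ▸ (iL.sub iT).sub iB, ?_⟩
  have iLT : Integrable fun x => L x - T x := iL.sub iT
  rw [key, integral_sub iLT iB, integral_sub iL iT, zB, zT, sub_zero, sub_zero]

theorem bracket_skew (hξ : IsTest ξ) (hη : IsTest η) :
    bracket (hydroOp q Γ W σ) ξ η R = - bracket (hydroOp q Γ W σ) η ξ R := by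
  have c := fun α => H.contDiff_pairing hR hRU (contDiff_vel hR) hξ.1 α
  have c' := fun α => H.contDiff_pairing hR hRU (contDiff_vel hR) hη.1 α
  have s : ∀ α, HasCompactSupport (pairing W R (vel R) α ξ) := fun α =>
    hasCompactSupport_of_eq_zero hξ.2 fun _ => pairing_eq_zero
  have s' : ∀ α, HasCompactSupport (pairing W R (vel R) α η) := fun α =>
    hasCompactSupport_of_eq_zero hη.2 fun _ => pairing_eq_zero
  have i1 := fun α => integrable_mul_invD (c α) (s α) (c' (σ α)) (s' (σ α))
  have i2 := fun α => integrable_mul_invD (c' α) (s' α) (c (σ α)) (s (σ α))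
  have l1 : Integrable (localDensity q Γ R ξ η) :=
    (H.contDiff_localDensity hR hRU hξ.1 hη.1).continuous.integrable_of_hasCompactSupport
      (hasCompactSupport_of_eq_zero hξ.2 fun _ => localDensity_eq_zero)
  have l2 : Integrable (localDensity q Γ R η ξ) :=
    (H.contDiff_localDensity hR hRU hη.1 hξ.1).continuous.integrable_of_hasCompactSupport
      (hasCompactSupport_of_eq_zero hη.2 fun _ => localDensity_eq_zero)
  have hl : ∫ x, (localDensity q Γ R ξ η x + localDensity q Γ R η ξ x) = 0 :=
    integral_deriv_eq_zero_of_hasCompactSupport (H.hasDerivAt_sum_metric hR hRU hξ.1 hη.1)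
      ((H.contDiff_localDensity hR hRU hξ.1 hη.1).add
        (H.contDiff_localDensity hR hRU hη.1 hξ.1)).continuous
      (hasCompactSupport_of_eq_zero hξ.2 fun x hx => by simp [hx])
  rw [integral_add l1 l2] at hl
  have hn : ∑ α, ∫ x, pairing W R (vel R) α ξ x * invD (pairing W R (vel R) (σ α) η) x
      = - ∑ α, ∫ x, pairing W R (vel R) α η x * invD (pairing W R (vel R) (σ α) ξ) x := by
    rw [← Equiv.sum_comp H.involutive.toPerm, ← Finset.sum_neg_distrib]
    refine Finset.sum_congr rfl fun α _ => ?_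
    simp only [Function.Involutive.coe_toPerm, H.involutive α]
    exact integral_mul_invD (c _).continuous (s _) (c' _).continuous (s' _)
  simp only [bracket, sum_mul_hydroOp]
  rw [integral_add l1 (integrable_finsetSum _ fun α _ => i1 α),
    integral_add l2 (integrable_finsetSum _ fun α _ => i2 α),
    integral_finsetSum _ fun α _ => i1 α, integral_finsetSum _ fun α _ => i2 α]
  linarith

/-- The double bracket in covariant form. -/
theorem doubleBracket_eq (hξ : IsTest ξ) (hη : IsTest η) (hζ : IsTest ζ) :
    doubleBracket (hydroOp q Γ W σ) ξ η ζ R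
      = ∫ x, ∑ i, (covVar Γ R (hydroOp q Γ W σ R ζ) ξ x i * hydroOp q Γ W σ R η x i
        - covVar Γ R (hydroOp q Γ W σ R ζ) η x i * hydroOp q Γ W σ R ξ x i
        + hydroOp q Γ W σ R ζ x i
          * (covD Γ R η x i * tail W σ R ξ x i - covD Γ R ξ x i * tail W σ R η x i)) := by
  have hV := H.contDiff_hydroOp hR hRU hζ
  rw [doubleBracket, (H.hasDerivAt_bracket hR hRU hV hξ hη).deriv]
  exact (H.integral_variation hR hRU hV hξ hη).2

omit hR in
-- The absence of torsion makes `Γ^j_{ki} V^k V'^i ξ_j` symmetric in the two vector fields.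
theorem sum_covVar_mul (x : ℝ) (V' : ℝ → Fin n → ℝ) :
    ∑ i, covVar Γ R V ξ x i * V' x i = ∑ i, covVar Γ R V' ξ x i * V x i := by
  have h : ∀ V V' : ℝ → Fin n → ℝ, ∑ i, covVar Γ R V ξ x i * V' x i
      = - ∑ j, ξ x j * ∑ i, conn Γ (R x) (V x) j i * V' x i := by
    intro V V'
    simp only [covVar, neg_mul, Finset.sum_neg_distrib, Finset.sum_mul, Finset.mul_sum]
    rw [Finset.sum_comm]
    congr 1
    exact Finset.sum_congr rfl fun i _ => Finset.sum_congr rfl fun k _ => by ring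
  rw [h, h]
  simp only [H.conn_symm (hRU x) (V x)]

theorem jacobi (hξ : IsTest ξ) (hη : IsTest η) (hζ : IsTest ζ) :
    doubleBracket (hydroOp q Γ W σ) ξ η ζ R + doubleBracket (hydroOp q Γ W σ) η ζ ξ R
      + doubleBracket (hydroOp q Γ W σ) ζ ξ η R = 0 := by
  have i1 := (H.integral_variation hR hRU (H.contDiff_hydroOp hR hRU hζ) hξ hη).1
  have i2 := (H.integral_variation hR hRU (H.contDiff_hydroOp hR hRU hξ) hη hζ).1
  have i3 := (H.integral_variation hR hRU (H.contDiff_hydroOp hR hRU hη) hζ hξ).1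
  rw [H.doubleBracket_eq hR hRU hξ hη hζ, H.doubleBracket_eq hR hRU hη hζ hξ,
    H.doubleBracket_eq hR hRU hζ hξ hη, ← integral_add i1 i2, ← integral_add (i1.fun_add i2) i3]
  refine integral_eq_zero_of_ae (Filter.Eventually.of_forall fun x => ?_)
  have t1 := H.sum_covVar_mul hRU (ξ := ξ) (V := hydroOp q Γ W σ R ζ) x (hydroOp q Γ W σ R η)
  have t2 := H.sum_covVar_mul hRU (ξ := η) (V := hydroOp q Γ W σ R ξ) x (hydroOp q Γ W σ R ζ)
  have t3 := H.sum_covVar_mul hRU (ξ := ζ) (V := hydroOp q Γ W σ R η) x (hydroOp q Γ W σ R ξ)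
  -- For each `i` this is the expansion of a `3 × 3` determinant with columns `ζ`, `η`, `ξ` and rows
  -- `hydroOp`, `covD`, `tail`. It vanishes because the first row is `q i` times the second plus
  -- `R_x^i` times the third; this uses that the metric and the affinors are diagonal.
  have t4 : ∑ i, hydroOp q Γ W σ R ζ x i
          * (covD Γ R η x i * tail W σ R ξ x i - covD Γ R ξ x i * tail W σ R η x i)
      + ∑ i, hydroOp q Γ W σ R ξ x i
          * (covD Γ R ζ x i * tail W σ R η x i - covD Γ R η x i * tail W σ R ζ x i)
      + ∑ i, hydroOp q Γ W σ R η x i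
          * (covD Γ R ξ x i * tail W σ R ζ x i - covD Γ R ζ x i * tail W σ R ξ x i) = 0 := by
    rw [← Finset.sum_add_distrib, ← Finset.sum_add_distrib]
    refine Finset.sum_eq_zero fun i _ => ?_
    simp only [hydroOp]
    ring
  simp only [Pi.zero_apply, Finset.sum_add_distrib, Finset.sum_sub_distrib]
  linarith

end Bracket

theorem isHamiltonian (H : HydroStructure U q Γ W σ) : IsHamiltonian U (hydroOp q Γ W σ) where
  integrable _ hR hRU _ _ hξ hη := H.integrable_bracket hR hRU hξ hη
  skew _ hR hRU _ _ hξ hη := H.bracket_skew hR hRU hξ hη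
  differentiable _ hR hRU _ _ _ hξ hη hζ :=
    (H.hasDerivAt_bracket hR hRU (H.contDiff_hydroOp hR hRU hζ) hξ hη).differentiableAt
  jacobi _ hR hRU _ _ _ hξ hη hζ := H.jacobi hR hRU hξ hη hζ

end HydroStructure

/-! ### The transformed operator as an instance of the general result. -/

/-- The `2N` tails are indexed by two copies of `Fin N`, and the swap of the copies is the
involution pairing each `p β` with `q β` of the operator. -/
theorem nonlocalOp_eq_hydroOp {n N : ℕ} (g : Fin n → (Fin n → ℝ) → ℝ)
    (p r : Fin N → Fin n → (Fin n → ℝ) → ℝ) :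
    nonlocalOp (diagMetric g) p r
      = hydroOp (fun i R => (diagMetric g R)⁻¹ i i) (christoffel (diagMetric g))
          (Sum.elim p r) Sum.swap := by
  funext R ψ x i
  have h : ∀ (R : Fin n → ℝ) (φ : Fin n → ℝ), ∑ j, (diagMetric g R)⁻¹ i j * φ j
      = (diagMetric g R)⁻¹ i i * φ i := fun R φ =>
    Finset.sum_eq_single i (fun j _ hj => by rw [inv_diagMetric_of_ne hj.symm, zero_mul])
      (fun hi => absurd (Finset.mem_univ i) hi)
  have h2 : ∑ j, ∑ s, ∑ k, (diagMetric g (R x))⁻¹ i s * christoffel (diagMetric g) j s k (R x)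
        * deriv (fun y => R y k) x * ψ x j
      = (diagMetric g (R x))⁻¹ i i
        * ∑ j, conn (christoffel (diagMetric g)) (R x) (vel R x) j i * ψ x j := by
    rw [Finset.mul_sum]
    refine Finset.sum_congr rfl fun j _ => ?_
    have := h (R x) fun s => ∑ k, christoffel (diagMetric g) j s k (R x)
      * deriv (fun y => R y k) x * ψ x j
    simp only [Finset.mul_sum, ← mul_assoc] at this
    rw [this, conn, Finset.sum_mul, Finset.mul_sum]
    refine Finset.sum_congr rfl fun k _ => ?_
    rw [christoffel_diag_comm g j i k, vel]
    ring
  have h3 : ∀ (y : Fin N → Fin n → (Fin n → ℝ) → ℝ) (β : Fin N) (α : Fin N ⊕ Fin N)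
      (_ : ∀ j, Sum.elim p r α j = y β j),
      (fun z => ∑ j, y β j (R z) * deriv (fun t => R t j) z * ψ z j)
        = pairing (Sum.elim p r) R (vel R) α ψ := by
    intro y β α hα
    funext z
    simp only [pairing, vel, hα]
  rw [nonlocalOp, h (R x) fun j => deriv (fun y => ψ y j) x, h2, hydroOp, covD, tail,
    Fintype.sum_sum_type]
  simp only [Sum.swap_inl, Sum.swap_inr, Sum.elim_inl, Sum.elim_inr,
    h3 r _ (Sum.inr _) fun _ => rfl, h3 p _ (Sum.inl _) fun _ => rfl]
  have hv : deriv (fun y => R y i) x = vel R x i := rfl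
  rw [mul_sub, mul_add, add_assoc, hv]
  congr 2 <;> rw [Finset.mul_sum] <;>
    exact Finset.sum_congr rfl fun β _ => by ring

theorem ReciprocalSetup.hydroStructure {n N : ℕ} [NeZero N] {U : Set (Fin n → ℝ)}
    {g : Fin n → (Fin n → ℝ) → ℝ} {v : Fin N → Fin n → (Fin n → ℝ) → ℝ}
    {a c : Fin N → Fin N → (Fin n → ℝ) → ℝ} (H : ReciprocalSetup U g v a c) :
    HydroStructure U (fun i R => (diagMetric (newMetric g a v) R)⁻¹ i i)
      (christoffel (diagMetric (newMetric g a v)))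
      (Sum.elim (newSpeed a v) (newExtraSpeed g a c v)) Sum.swap where
  isOpen := H.isOpen
  involutive := Sum.swap_swap
  contDiffOn_metric i := ((H.contDiffOn_newMetric i).inv (H.newMetric_ne_zero i)).congr
    fun R hR => by
      rw [inv_diagMetric fun i => H.newMetric_ne_zero i R hR, if_pos rfl]; rfl
  contDiffOn_conn := contDiffOn_christoffel H.isOpen H.contDiffOn_newMetric H.newMetric_ne_zero
  contDiffOn_affinor
    | Sum.inl β, i => H.contDiffOn_newSpeed β i
    | Sum.inr β, i => H.contDiffOn_newExtraSpeed β i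
  symm R _ i j k := christoffel_diag_comm _ i j k R
  metric R hR i j k := by
    have h0 : ∀ i, newMetric g a v i R ≠ 0 := fun i => H.newMetric_ne_zero i R hR
    have hq : pd k (fun S => (diagMetric (newMetric g a v) S)⁻¹ i i) R
        = - (2 * (newMetric g a v i R)⁻¹ * logDeriv (newMetric g a v) i k R) := by
      rw [pd_congr H.isOpen (f' := fun S => (newMetric g a v i S)⁻¹) (fun S hS => by
          rw [inv_diagMetric fun i => H.newMetric_ne_zero i S hS, if_pos rfl]) hR,
        pd_inv (differentiableAt_of_mem H.isOpen (H.contDiffOn_newMetric i) hR) (h0 i),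
        pd_metric h0]
      have := h0 i
      field_simp
    rw [inv_diagMetric h0, inv_diagMetric h0, if_pos rfl, if_pos rfl, add_assoc,
      christoffel_diag_metric h0, hq]
    split_ifs <;> simp
  codazzi
    | Sum.inl β, R, hR, i, j, k =>
      codazzi_christoffel (fun i => H.newMetric_ne_zero i R hR)
        (fun _ _ hij => H.codazzi_newSpeed hR β hij) i j k
    | Sum.inr β, R, hR, i, j, k =>
      codazzi_christoffel (fun i => H.newMetric_ne_zero i R hR)
        (fun _ _ hij => H.codazzi_newExtraSpeed hR β hij) i j k
  -- The sum over both copies of `Fin N` reproduces the two symmetric halves of the curvature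
  -- formula.
  gauss R hR i j k l := by
    have h0 : ∀ i, newMetric g a v i R ≠ 0 := fun i => H.newMetric_ne_zero i R hR
    have h := H.curvature_newMetric hR i j k l
    rw [curvature_diag h0] at h
    rw [inv_diagMetric h0, if_pos rfl, Fintype.sum_sum_type, ← riemann, h,
      Finset.sum_add_distrib]
    simp only [Sum.swap_inl, Sum.swap_inr, Sum.elim_inl, Sum.elim_inr,
      mul_comm (newSpeed a v _ j R)]

end RecipTransf
end

theorem theorem4 {n N : ℕ} [NeZero N] (U : Set (Fin n → ℝ)) (hU : IsOpen U)
    -- the flat diagonal metric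
    (g : Fin n → (Fin n → ℝ) → ℝ) (hg : ∀ i, ContDiffOn ℝ ∞ (g i) U)
    (hg0 : ∀ i, ∀ R ∈ U, g i R ≠ 0)
    (hflat : ∀ R ∈ U, ∀ i j k l, RecipTransf.curvature (RecipTransf.diagMetric g) i j k l R = 0)
    -- the diagonal flows with speeds `v`, generated by the densities `h`
    (h : Fin N → (Fin n → ℝ) → ℝ) (hh : ∀ β, ContDiffOn ℝ ∞ (h β) U)
    (v : Fin N → Fin n → (Fin n → ℝ) → ℝ)
    (hv : ∀ β, ∀ R ∈ U, ∀ i j,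
      RecipTransf.mixedHess (RecipTransf.diagMetric g) (h β) i j R = if i = j then v β i R else 0)
    (hv1 : ∀ i, ∀ R ∈ U, v 0 i R = 1)
    -- `a γ 0` are conserved densities of the flows, with fluxes `a γ β`
    (a : Fin N → Fin N → (Fin n → ℝ) → ℝ) (ha : ∀ γ β, ContDiffOn ℝ ∞ (a γ β) U)
    (hcons : ∀ γ β, ∀ R ∈ U, ∀ i,
      RecipTransf.pd i (a γ β) R = v β i R * RecipTransf.pd i (a γ 0) R)
    (hdet : ∀ R ∈ U, IsUnit (Matrix.of fun γ β => a γ β R).det)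
    (hnz : ∀ R ∈ U, ∀ i, RecipTransf.speedSum a v 0 i R ≠ 0)
    -- the flows generated by `a γ 0` are diagonal; this has to be required only where all the
    -- speeds in two directions coincide
    (hdiag : ∀ R ∈ U, ∀ i j, i ≠ j → (∀ β, v β i R = v β j R) →
      ∀ γ, RecipTransf.mixedHess (RecipTransf.diagMetric g) (a γ 0) i j R = 0)
    -- `c γ β` is the flux of the density `a γ 0` along the flow generated by `a β 0`
    (c : Fin N → Fin N → (Fin n → ℝ) → ℝ) (hc : ∀ γ β, ContDiffOn ℝ ∞ (c γ β) U)
    (hflux : ∀ γ β, ∀ R ∈ U, ∀ i,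
      RecipTransf.pd i (c γ β) R = RecipTransf.extraSpeed g a β i R * RecipTransf.pd i (a γ 0) R)
    (hnorm : ∀ γ β, ∀ R ∈ U,
      c γ β R + c β γ R
        = ∑ k, (g k R)⁻¹ * RecipTransf.pd k (a β 0) R * RecipTransf.pd k (a γ 0) R) :
    (∀ R ∈ U, ∀ i j k l,
      RecipTransf.curvature (RecipTransf.diagMetric (RecipTransf.newMetric g a v)) i j k l R
        = (∑ β, (RecipTransf.newSpeed a v β i R * RecipTransf.newExtraSpeed g a c v β j R
            + RecipTransf.newSpeed a v β j R * RecipTransf.newExtraSpeed g a c v β i R))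
          * ((if i = k then 1 else 0) * (if j = l then 1 else 0)
            - (if i = l then 1 else 0) * (if j = k then 1 else 0)))
    ∧ RecipTransf.IsHamiltonian U
        (RecipTransf.nonlocalOp (RecipTransf.diagMetric (RecipTransf.newMetric g a v))
          (RecipTransf.newSpeed a v) (RecipTransf.newExtraSpeed g a c v)) := by
  -- Smoothness of the speeds is inherited from the densities `h`, since each speed is a diagonal
  -- entry of a mixed Hessian.
  have hG : ∀ β i, ContDiffOn ℝ ∞ (v β i) U := fun β i =>
    (RecipTransf.contDiffOn_mixedHess hU hg hg0 (hh β) i i).congr fun R hR => by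
      rw [hv β R hR, if_pos rfl]
  have hcod : ∀ β, ∀ R ∈ U, ∀ i j, i ≠ j → RecipTransf.pd j (v β i) R
      = RecipTransf.logDeriv g i j R * (v β j R - v β i R) := fun β R hR i j hij =>
    RecipTransf.codazzi_of_mixedHess hU hg hg0 hflat (hh β) (hG β) (hv β) hR hij
  have H : RecipTransf.ReciprocalSetup U g v a c :=
    { isOpen := hU
      contDiffOn_metric := hg
      metric_ne_zero := hg0
      flat := hflat
      contDiffOn_speed := hG
      codazzi_speed := hcod
      contDiffOn_flux := ha
      pd_flux := hcons
      isUnit_det := hdet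
      speedSum_ne_zero := hnz
      mixedHess_density := fun γ R hR i j => by
        by_cases hij : i = j
        · subst hij
          rw [if_pos rfl, RecipTransf.extraSpeed]
        · rw [if_neg hij]
          -- Where all speeds in the two directions coincide, diagonality is assumed; elsewhere a
          -- single flow separating the directions forces it.
          by_cases hvij : ∀ β, v β i R = v β j R
          · exact hdiag R hR i j hij hvij γ
          · obtain ⟨β, hβ⟩ := not_forall.1 hvij
            exact RecipTransf.mixedHess_eq_zero_of_conserved hU hg0 (hG β) (hcod β) (ha γ 0)
              (ha γ β) (hcons γ β) hR hij hβ
      contDiffOn_extraFlux := hc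
      pd_extraFlux := hflux
      extraFlux_add := hnorm }
  refine ⟨fun R hR => H.curvature_newMetric hR, ?_⟩
  rw [RecipTransf.nonlocalOp_eq_hydroOp]
  exact H.hydroStructure.isHamiltonian
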